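/- Let $(X,d)$ be a compact geodesic metric space, let $p\in X$, and let $f=d(p,\cdot):X\to\mathbb R$. A contour of $f$ is a connected component of a level set $f^{-1}(c)$, $c\in f(X)$. The Reeb graph $R_f$ is the quotient of $X$ obtained by contracting each contour to a point, with the quotient topology; $\varphi:X\to R_f$ is the quotient map and $\bar f:R_f\to\mathbb R$ is the function with $f=\bar f\circ\varphi$. Suppose that $R_f$ is a finite topological graph, i.e. homeomorphic to a finite simplicial complex of dimension at most one. Endow $R_f$ with its intrinsic distance $$d_{R}(a,b)=\inf_\gamma \operatorname{Var}(\bar f\circ\gamma),$$ where $\gamma$ ranges over the continuous paths in $R_f$ from $a$ to $b$ and $\operatorname{Var}$ denotes total variation. Then $d_R$ is a (finite) metric inducing the quotient topology of $R_f$, and the distortion $\operatorname{dis}(\varphi)=\sup_{x,x'\in X}|d(x,x')-d_R(\varphi(x),\varphi(x'))|$ satisfies $$\operatorname{dis}(\varphi)\le 2\,(b_1'(X)+1)\,D,$$ where $D$ is the supremum of the diameters of the contours of $f$ and $b_1'(X)=\operatorname{corank}(\pi_1(X))\in\{0,1,2,\dots,\infty\}$ is the supremum of the integers $n$ such that the free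 group of rank $n$ is a homomorphic image of $\pi_1(X)$ (with the convention $\infty\cdot 0=0$). In particular, the Gromov–Hausdorff distance satisfies $$d_{GH}(X,R_f)\le (b_1'(X)+1)\,D.$$ -/

import Mathlib

open Set
open scoped ENNReal

universe u

/-- A metric space is geodesic if any two points `x`, `y` are joined by a shortest path, i.e. by an
isometrically embedded segment of length `dist x y`. -/
def IsGeodesicSpace (X : Type*) [MetricSpace X] : Prop :=
  ∀ x y : X, ∃ γ : ℝ → X, γ 0 = x ∧ γ (dist x y) = y ∧
    ∀ s ∈ Icc 0 (dist x y), ∀ t ∈ Icc 0 (dist x y), dist (γ s) (γ t) = |s - t|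

/-- The contour of `f` through `x`: the connected component of `x` in the level set of `f`
containing `x`. -/
def contour {X : Type*} [TopologicalSpace X] (f : X → ℝ) (x : X) : Set X :=
  connectedComponentIn (f ⁻¹' {f x}) x

theorem mem_contour_self {X : Type*} [TopologicalSpace X] (f : X → ℝ) (x : X) :
    x ∈ contour f x :=
  mem_connectedComponentIn (by simp)

/-- Two points are equivalent if they belong to the same contour. -/
def reebSetoid {X : Type*} [TopologicalSpace X] (f : X → ℝ) : Setoid X :=
  Setoid.ker (contour f)

/-- The Reeb graph of `f`: the set of contours of `f`. -/
def ReebGraph {X : Type*} [TopologicalSpace X] (f : X → ℝ) : Type _ :=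
  Quotient (reebSetoid f)

/-- The Reeb graph carries the quotient topology. -/
instance instTopologicalSpaceReebGraph {X : Type*} [TopologicalSpace X] (f : X → ℝ) :
    TopologicalSpace (ReebGraph f) :=
  inferInstanceAs (TopologicalSpace (Quotient (reebSetoid f)))

/-- The Reeb quotient map. -/
def reebMap {X : Type*} [TopologicalSpace X] (f : X → ℝ) : X → ReebGraph f :=
  Quotient.mk (reebSetoid f)

/-- The function on the Reeb graph induced by `f`. -/
def reebFun {X : Type*} [TopologicalSpace X] (f : X → ℝ) : ReebGraph f → ℝ :=
  Quotient.lift f (by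
    intro x y h
    have h' : contour f x = contour f y := h
    have hx : x ∈ contour f y := h' ▸ mem_contour_self f x
    simpa using connectedComponentIn_subset _ _ hx)

/-- The intrinsic distance on the Reeb graph: the infimum of the lengths of the paths in the Reeb
graph joining `a` and `b`, the length of a path being the total variation along it of the function
induced by `f`. (On an edge of the graph on which the induced function is monotone, the length is
the difference of its values at the ends.) -/
noncomputable def reebEDist {X : Type*} [TopologicalSpace X] (f : X → ℝ)
    (a b : ReebGraph f) : ℝ≥0∞ :=
  ⨅ γ : Path a b, eVariationOn (fun t => reebFun f (γ t)) univ

/-- A finite topological graph: a space homeomorphic to (the underlying space of) a finite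
simplicial complex of dimension at most one. A finite graph with loops or multiple edges is
homeomorphic to such a complex by subdivision. -/
def IsFiniteTopologicalGraph (G : Type*) [TopologicalSpace G] : Prop :=
  ∃ (n : ℕ) (K : Geometry.SimplicialComplex ℝ (EuclideanSpace ℝ (Fin n))),
    K.faces.Finite ∧ (∀ s ∈ K.faces, s.card ≤ 2) ∧ Nonempty (G ≃ₜ K.space)

/-- The co-rank of a group: the maximum (`⊤` if unbounded) rank of a free homomorphic image. -/
noncomputable def corank (G : Type*) [Group G] : ℕ∞ :=
  ⨆ (n : ℕ) (_ : ∃ φ : G →* FreeGroup (Fin n), Function.Surjective φ), (n : ℕ∞)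

/-- The distortion of a map between metric spaces. -/
noncomputable def distortion {X Y : Type*} [MetricSpace X] [MetricSpace Y] (φ : X → Y) : ℝ≥0∞ :=
  ⨆ (x : X) (x' : X), ENNReal.ofReal |dist x x' - dist (φ x) (φ x')|

/-- The supremum of the diameters of the contours of `f`. -/
noncomputable def contourDiam {X : Type*} [MetricSpace X] (f : X → ℝ) : ℝ≥0∞ :=
  ⨆ x : X, Metric.ediam (contour f x)

/-! A geodesic from `x` to `p` strictly decreases `f`, so the height `f̄` on the Reeb graph has no
local minimum except at `φ p`. Cutting the finitely many arcs at their local maxima therefore yields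
finitely many arcs on which the height is strictly monotone, and every vertex other than `φ p` is
the top of at least one arc. Selecting one such arc per vertex gives a spanning tree; let `N` be the
set of remaining arcs.

The number of arcs in `N` is at most the corank of the fundamental group. The preimage of the graph
cut at the midpoints of the arcs in `N` is path connected, and so is the preimage of each open arc.
Gluing copies of these sets indexed by the free group on `N` gives a path connected covering of `X`
with that deck group, hence a surjection from the fundamental group (`card_le_corank`).

The map `φ` is 1-Lipschitz because `f` is, so only an upper bound for `d(x, x')` is needed. Make `φ
x` and `φ x'` vertices and let `ρ` be the distance from `φ x` in the weighted graph; then `ρ (φ x')`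
is at most the intrinsic distance (`ofReal_sub_le_reebEDist`). A shortest path is lifted arc by arc
(`dist_le_potential`). A descending lift can leave the prescribed arc only at a vertex that is the
top of several arcs, and there are at most `N.card` of these. Each costs at most two jumps inside a
contour, and one more jump occurs at an end or a local minimum, so the total error is at most `(2 *
N.card + 1) * D`.

Positivity of `ρ` away from `φ x` makes the intrinsic distance a metric, and compactness identifies
its topology with the quotient topology. -/

/-! ### Coverings glued from locally constant cocycles, and free quotients of the fundamental group
-/

/-- The total space of the principal `G`-bundle over `X` with locally constant transition functions
`(κ i)⁻¹ * κ j` on `U i ∩ U j`; as a set it is `X × G`. -/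
structure GluedCover {X ι G : Type*} (U : ι → Set X) (κ : ι → X → G) where
  base : X
  val : G

namespace GluedCover

variable {X ι G : Type*} [Group G] {U : ι → Set X} {κ : ι → X → G}

/-- The flat section over `U i` with constant coordinate `a`. -/
def sec (U : ι → Set X) (κ : ι → X → G) (i : ι) (a : G) (x : X) : GluedCover U κ :=
  ⟨x, a * (κ i x)⁻¹⟩

instance : SMul G (GluedCover U κ) := ⟨fun g e => ⟨e.base, g * e.val⟩⟩

theorem smul_def (g : G) (e : GluedCover U κ) : g • e = ⟨e.base, g * e.val⟩ := rfl

instance : MulAction G (GluedCover U κ) where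
  one_smul e := by simp [smul_def]
  mul_smul a b e := by simp [smul_def, mul_assoc]

theorem smul_sec (g : G) (i : ι) (a : G) (x : X) :
    g • sec U κ i a x = sec U κ i (g * a) x := by
  simp [smul_def, sec, mul_assoc]

theorem exists_sec (hcov : ∀ x, ∃ i, x ∈ U i) (e : GluedCover U κ) :
    ∃ i a, e.base ∈ U i ∧ sec U κ i a e.base = e := by
  obtain ⟨i, hi⟩ := hcov e.base
  exact ⟨i, e.val * κ i e.base, hi, by simp [sec]⟩

variable [TopologicalSpace X]

instance : TopologicalSpace (GluedCover U κ) :=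
  ⨆ (i : ι) (a : G), TopologicalSpace.coinduced (fun x : U i => sec U κ i a x) inferInstance

theorem isOpen_iff (hU : ∀ i, IsOpen (U i)) {W : Set (GluedCover U κ)} :
    IsOpen W ↔ ∀ i a, IsOpen (U i ∩ sec U κ i a ⁻¹' W) := by
  simp only [isOpen_iSup_iff, isOpen_coinduced]
  refine forall₂_congr fun i a => ?_
  rw [← Subtype.image_preimage_coe, ← (hU i).isOpenEmbedding_subtypeVal.isOpen_iff_image_isOpen]
  rfl

theorem continuous_sec (i : ι) (a : G) : Continuous (fun x : U i => sec U κ i a x) :=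
  continuous_iff_coinduced_le.2 (le_iSup₂_of_le i a le_rfl)

/-- Two flat sections agree exactly where the transition function takes one prescribed value, and
this is an open set because the transitions are locally constant. -/
theorem isOpen_image_sec (hU : ∀ i, IsOpen (U i))
    (hκ : ∀ i j c, IsOpen {x | x ∈ U i ∩ U j ∧ (κ i x)⁻¹ * κ j x = c}) (i : ι) (a : G) :
    IsOpen (sec U κ i a '' U i) := by
  rw [isOpen_iff hU]
  intro j b
  convert hκ i j (a⁻¹ * b) using 1
  ext x
  have hG : a * (κ i x)⁻¹ = b * (κ j x)⁻¹ ↔ (κ i x)⁻¹ * κ j x = a⁻¹ * b := by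
    constructor <;> intro h
    · rw [show (κ i x)⁻¹ = a⁻¹ * (b * (κ j x)⁻¹) by rw [← h]; group]
      group
    · rw [show b = a * ((κ i x)⁻¹ * κ j x) by rw [h]; group]
      group
  simp only [mem_ofPred_eq, ← hG]
  constructor
  · rintro ⟨hj, y, hy, h⟩
    simp only [sec, GluedCover.mk.injEq] at h
    obtain ⟨rfl, h⟩ := h
    exact ⟨⟨hy, hj⟩, h⟩
  · rintro ⟨⟨hi, hj⟩, h⟩
    exact ⟨hj, x, hi, by simp only [sec, h]⟩

/-- Left multiplication commutes with the right-multiplying transitions, so `G` acts on the glued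
space, simply transitively on fibres. The image of a flat section is an open set disjoint from its
nontrivial translates. -/
theorem isQuotientCoveringMap (hU : ∀ i, IsOpen (U i)) (hcov : ∀ x, ∃ i, x ∈ U i)
    (hκ : ∀ i j c, IsOpen {x | x ∈ U i ∩ U j ∧ (κ i x)⁻¹ * κ j x = c}) :
    IsQuotientCoveringMap (base : GluedCover U κ → X) G := by
  have hcont : Continuous (base : GluedCover U κ → X) := by
    refine continuous_def.2 fun V hV => (isOpen_iff hU).2 fun i a => (hU i).inter hV
  have hopen : IsOpenMap (base : GluedCover U κ → X) := by
    intro W hW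
    have : base '' W = ⋃ (i : ι) (a : G), U i ∩ sec U κ i a ⁻¹' W := by
      ext x
      simp only [mem_image, mem_iUnion]
      constructor
      · rintro ⟨e, he, rfl⟩
        obtain ⟨i, a, hi, h⟩ := exists_sec hcov e
        exact ⟨i, a, hi, by simpa [h] using he⟩
      · rintro ⟨i, a, _, h⟩
        exact ⟨_, h, rfl⟩
    rw [this]
    exact isOpen_iUnion fun i => isOpen_iUnion fun a => (isOpen_iff hU).1 hW i a
  have hsurj : Function.Surjective (base : GluedCover U κ → X) := fun x => ⟨⟨x, 1⟩, rfl⟩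
  refine
    { toIsQuotientMap := hopen.isQuotientMap hcont hsurj
      continuous_const_smul := fun g => ?_
      apply_eq_iff_mem_orbit := fun {e₁ e₂} => ⟨fun h => ?_, ?_⟩
      disjoint := fun e => ?_ }
  · refine continuous_def.2 fun W hW => (isOpen_iff hU).2 fun i a => ?_
    have := (isOpen_iff hU).1 hW i (g * a)
    simpa only [preimage, smul_sec, mem_ofPred_eq] using this
  · obtain ⟨x, a⟩ := e₁
    obtain ⟨y, b⟩ := e₂
    obtain rfl : x = y := h
    exact ⟨a * b⁻¹, by simp [smul_def]⟩
  · rintro ⟨g, rfl⟩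
    rfl
  · obtain ⟨i, a, hi, h⟩ := exists_sec hcov e
    refine ⟨sec U κ i a '' U i, (isOpen_image_sec hU hκ i a).mem_nhds ⟨_, hi, h⟩, fun g => ?_⟩
    rintro ⟨_, ⟨_, ⟨x, hx, rfl⟩, rfl⟩, ⟨y, hy, hxy⟩⟩
    simp only [sec, smul_def, GluedCover.mk.injEq] at hxy
    obtain ⟨rfl, h2⟩ := hxy
    simpa using h2

theorem joined_sec {i : ι} {x y : X} (h : JoinedIn (U i) x y) (a : G) :
    Joined (sec U κ i a x) (sec U κ i a y) := by
  have := (joinedIn_iff_joined h.source_mem h.target_mem).1 h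
  exact this.map (continuous_sec i a)

end GluedCover

/-- If `X` is covered by an open path connected set `U₀` and pairwise disjoint open path connected
sets `U j` such that `U₀ ∩ U j` is separated by `A j`, then the free group on the index set is a
homomorphic image of the fundamental group. -/
theorem exists_surjective_freeGroup {X N : Type*} [TopologicalSpace X] (p : X) (U₀ : Set X)
    (U A : N → Set X) (hU₀ : IsOpen U₀) (hU₀c : IsPathConnected U₀) (hp : p ∈ U₀)
    (hU : ∀ j, IsOpen (U j)) (hUc : ∀ j, IsPathConnected (U j))
    (hdisj : Pairwise fun i j => Disjoint (U i) (U j))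
    (hcov : ∀ x, x ∈ U₀ ∨ ∃ j, x ∈ U j)
    (hA : ∀ j, IsOpen (U₀ ∩ U j ∩ A j)) (hA' : ∀ j, IsOpen ((U₀ ∩ U j) \ A j))
    (hne : ∀ j, (U₀ ∩ U j ∩ A j).Nonempty) (hne' : ∀ j, ((U₀ ∩ U j) \ A j).Nonempty) :
    ∃ Φ : FundamentalGroup X p →* FreeGroup N, Function.Surjective Φ := by
  classical
  let V : Option N → Set X := fun i => i.elim U₀ U
  -- Over `U j`, the sheets are shifted by the generator `j` on the side `A j` and not on the other
  -- side.
  let κ : Option N → X → FreeGroup N :=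
    fun i x => i.elim 1 (fun j => if x ∈ A j then FreeGroup.of j else 1)
  have hV : ∀ i, IsOpen (V i) := by
    rintro (_ | j)
    exacts [hU₀, hU j]
  have hVc : ∀ i, IsPathConnected (V i) := by
    rintro (_ | j)
    exacts [hU₀c, hUc j]
  have hcov' : ∀ x, ∃ i, x ∈ V i := fun x => by
    rcases hcov x with h | ⟨j, h⟩
    exacts [⟨none, h⟩, ⟨some j, h⟩]
  have key : ∀ j (q : FreeGroup N → Prop), IsOpen {x | x ∈ U₀ ∩ U j ∧ q (κ (some j) x)} := by
    intro j q
    have : {x | x ∈ U₀ ∩ U j ∧ q (κ (some j) x)} =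
        {x | x ∈ U₀ ∩ U j ∩ A j ∧ q (FreeGroup.of j)} ∪ {x | x ∈ (U₀ ∩ U j) \ A j ∧ q 1} := by
      ext x
      by_cases hx : x ∈ A j <;> simp [κ, hx, and_assoc]
    rw [this]
    refine IsOpen.union ?_ ?_
    · by_cases hq : q (FreeGroup.of j)
      · simpa only [hq, and_true, ofPred_mem_eq] using hA j
      · simp [hq]
    · by_cases hq : q 1
      · simpa only [hq, and_true, ofPred_mem_eq] using hA' j
      · simp [hq]
  have hκ : ∀ i j c, IsOpen {x | x ∈ V i ∩ V j ∧ (κ i x)⁻¹ * κ j x = c} := by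
    rintro (_ | i) (_ | j) c
    · by_cases hc : 1 = c
      · simpa [V, κ, hc] using hU₀
      · simp [V, κ, hc]
    · exact key j fun g => 1⁻¹ * g = c
    · simpa only [V, inter_comm, Option.elim] using! key i fun g => g⁻¹ * 1 = c
    · by_cases hij : i = j
      · subst hij
        by_cases hc : 1 = c
        · simpa [V, hc] using hU i
        · simp [hc]
      · have : V (some i) ∩ V (some j) = ∅ := (hdisj hij).inter_eq
        simp [this]
  have hcovering := GluedCover.isQuotientCoveringMap hV hcov' hκ
  have hjoin : ∀ i (a : FreeGroup N) {x y : X}, x ∈ V i → y ∈ V i →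
      Joined (GluedCover.sec V κ i a x) (GluedCover.sec V κ i a y) := fun i a x y hx hy =>
    GluedCover.joined_sec ((hVc i).joinedIn x hx y hy) a
  have hnone : ∀ (g : FreeGroup N) {x y : X}, x ∈ U₀ → y ∈ U₀ →
      Joined (⟨x, g⟩ : GluedCover V κ) ⟨y, g⟩ := fun g x y hx hy => by
    simpa [GluedCover.sec, κ] using hjoin none g hx hy
  -- The section over `U j` with constant `g * of j` has second component `g` on `A j` and `g * of
  -- j` off `A j`. Entering `U j` through `A j` and leaving on the other side thus multiplies by the
  -- generator.
  have hgen : ∀ j (g : FreeGroup N),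
      Joined (⟨p, g⟩ : GluedCover V κ) ⟨p, g * FreeGroup.of j⟩ := fun j g => by
    obtain ⟨x, ⟨hx0, hxj⟩, hxA⟩ := hne j
    obtain ⟨y, ⟨hy0, hyj⟩, hyA⟩ := hne' j
    have h1 := hjoin (some j) (g * FreeGroup.of j) hxj hyj
    simp only [GluedCover.sec, κ, Option.elim, hxA, hyA, if_true, if_false, mul_inv_cancel_right,
      inv_one, mul_one] at h1
    exact ((hnone g hp hx0).trans h1).trans (hnone _ hy0 hp)
  have hall : ∀ h g : FreeGroup N, Joined (⟨p, g⟩ : GluedCover V κ) ⟨p, g * h⟩ := by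
    intro h
    induction h using FreeGroup.induction_on with
    | C1 => intro g; simpa using Joined.refl _
    | of j => exact hgen j
    | inv_of j _ => intro g; simpa using (hgen j (g * (FreeGroup.of j)⁻¹)).symm
    | mul x y hx hy => intro g; rw [← mul_assoc]; exact (hx g).trans (hy _)
  have hbase : ∀ e : GluedCover V κ, Joined (⟨p, 1⟩ : GluedCover V κ) e := by
    intro e
    have h0 : ∀ x g, x ∈ U₀ → Joined (⟨p, 1⟩ : GluedCover V κ) ⟨x, g⟩ := fun x g hx => by
      simpa using (hall g 1).trans (hnone _ hp hx)
    rcases hcov e.base with h | ⟨j, h⟩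
    · exact h0 _ _ h
    · obtain ⟨x, ⟨hx0, hxj⟩, hxA⟩ := hne j
      have h1 := hjoin (some j) (e.val * κ (some j) e.base) hxj h
      refine (h0 x _ hx0).trans (y := GluedCover.sec V κ (some j) (e.val * κ (some j) e.base) x) ?_
      convert h1
      simp [GluedCover.sec]
  have : PathConnectedSpace (GluedCover V κ) :=
    { nonempty := ⟨⟨p, 1⟩⟩, joined := fun a b => (hbase a).symm.trans (hbase b) }
  let e₀ : (GluedCover.base : GluedCover V κ → X) ⁻¹' {p} := ⟨⟨p, 1⟩, rfl⟩
  -- Monodromy of a connected covering is onto the opposite of the deck group; inversion removes the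
  -- opposite.
  refine ⟨(MulEquiv.inv' (FreeGroup N)).symm.toMonoidHom.comp
    (hcovering.fundamentalGroupToMulOpposite e₀), ?_⟩
  exact (MulEquiv.inv' (FreeGroup N)).symm.surjective.comp
    (hcovering.fundamentalGroupToMulOpposite_surjective e₀)

/-! ### Induction along a height; total variation and the intrinsic distance -/

/-- Strong induction on a finite set along a real-valued function. -/
theorem Finset.induction_on_height {α : Type*} (s : Finset α) (h : α → ℝ) {P : α → Prop}
    (step : ∀ v ∈ s, (∀ w ∈ s, h w < h v → P w) → P v) : ∀ v ∈ s, P v := by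
  classical
  by_contra! H
  obtain ⟨v, hv, hP⟩ := H
  obtain ⟨w, hw, hmin⟩ := (s.filter fun v => ¬P v).exists_min_image h
    ⟨v, Finset.mem_filter.2 ⟨hv, hP⟩⟩
  rw [Finset.mem_filter] at hw
  refine hw.2 (step w hw.1 fun x hx hlt => ?_)
  by_contra hPx
  exact (hmin x (Finset.mem_filter.2 ⟨hx, hPx⟩)).not_gt hlt

open scoped Topology in
/-- If the increments of `g` are locally dominated by those of `u`, then the total increment of `g`
is at most the variation of `u`. -/
theorem ofReal_sub_le_eVariationOn_of_eventually {g u : unitInterval → ℝ}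
    (h : ∀ t, ∀ᶠ s in 𝓝 t, |g s - g t| ≤ |u s - u t|) :
    ENNReal.ofReal (g 1 - g 0) ≤ eVariationOn u univ := by
  -- Continuous induction: the supremum of `A` lies in `A`, and if it were less than `1`, the local
  -- estimate would give larger elements of `A`.
  let A : Set unitInterval := {t | ENNReal.ofReal (g t - g 0) ≤ eVariationOn u (Icc 0 t)}
  have step : ∀ s t, s ≤ t → s ∈ A → |g t - g s| ≤ |u t - u s| → t ∈ A := by
    intro s t hst hs hle
    have h1 := eVariationOn.Icc_add_Icc u (s := univ) (unitInterval.nonneg' (t := s)) hst (mem_univ s)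
    simp only [univ_inter] at h1
    show ENNReal.ofReal (g t - g 0) ≤ eVariationOn u (Icc 0 t)
    rw [← h1]
    calc ENNReal.ofReal (g t - g 0) = ENNReal.ofReal ((g s - g 0) + (g t - g s)) := by ring_nf
      _ ≤ ENNReal.ofReal (g s - g 0) + ENNReal.ofReal (g t - g s) := ENNReal.ofReal_add_le
      _ ≤ _ := by
        refine add_le_add hs ?_
        calc ENNReal.ofReal (g t - g s) ≤ ENNReal.ofReal |u s - u t| :=
              ENNReal.ofReal_le_ofReal ((le_abs_self _).trans (by rwa [abs_sub_comm (u s)]))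
          _ = edist (u s) (u t) := by rw [edist_dist, Real.dist_eq]
          _ ≤ _ := eVariationOn.edist_le u (left_mem_Icc.2 hst) (right_mem_Icc.2 hst)
  have h0 : (0 : unitInterval) ∈ A := by simp [A]
  have hlub : IsLUB A (sSup A) := isLUB_sSup A
  have hc : sSup A ∈ A := by
    have h1 := hlub.frequently_mem ⟨0, h0⟩
    obtain ⟨s, hsA, hs, hsc⟩ := (h1.and_eventually
      (((h (sSup A)).filter_mono nhdsWithin_le_nhds).and self_mem_nhdsWithin)).exists
    refine step s _ hsc hsA ?_
    rwa [abs_sub_comm, abs_sub_comm (u _)]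
  rcases eq_or_lt_of_le (le_top : sSup A ≤ 1) with heq | hlt
  · rw [heq] at hc
    exact hc.trans (eVariationOn.mono u (subset_univ _))
  · have : (𝓝[>] (sSup A)).NeBot := nhdsGT_neBot_of_exists_gt ⟨1, hlt⟩
    obtain ⟨s, hs, hsc⟩ := (((h (sSup A)).filter_mono nhdsWithin_le_nhds).and
      (self_mem_nhdsWithin : Ioi (sSup A) ∈ 𝓝[>] (sSup A))).exists
    exact absurd (hlub.1 (step _ _ (le_of_lt hsc) hc hs)) (not_le.2 hsc)

section ReebEDist

variable {X : Type*} [TopologicalSpace X] (f : X → ℝ)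

theorem reebEDist_self (a : ReebGraph f) : reebEDist f a a = 0 :=
  le_antisymm ((iInf_le _ (Path.refl a)).trans
    (eVariationOn.constant_on (by
      rintro _ ⟨s, _, rfl⟩ _ ⟨t, _, rfl⟩
      rfl)).le) bot_le

theorem reebEDist_comm (a b : ReebGraph f) : reebEDist f a b = reebEDist f b a := by
  have key : ∀ a b, reebEDist f a b ≤ reebEDist f b a := fun a b => by
    refine le_iInf fun γ => (iInf_le _ γ.symm).trans ?_
    exact eVariationOn.comp_le_of_antitoneOn (fun t => reebFun f (γ t)) unitInterval.symm
      (fun x _ y _ h => unitInterval.symm_le_symm.2 h) (mapsTo_univ _ _)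
  exact le_antisymm (key a b) (key b a)

theorem reebEDist_triangle (a b c : ReebGraph f) :
    reebEDist f a c ≤ reebEDist f a b + reebEDist f b c := by
  refine ENNReal.le_iInf_add_iInf fun γ γ' => (iInf_le _ (γ.trans γ')).trans ?_
  let m : unitInterval := ⟨1 / 2, by norm_num, by norm_num⟩
  let F : unitInterval → ℝ := fun t => reebFun f ((γ.trans γ') t)
  have h1 := eVariationOn.union F (isGreatest_Iic (a := m)) (isLeast_Ici (a := m))
  rw [Iic_union_Ici] at h1
  show eVariationOn F univ ≤ _
  rw [h1]
  refine add_le_add ?_ ?_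
  -- Each half of the concatenated path is a monotone reparametrisation of one of the two paths,
  -- which does not increase variation.
  · let φ : unitInterval → unitInterval := fun t => projIcc 0 1 zero_le_one (2 * (t : ℝ))
    have : EqOn F ((fun t => reebFun f (γ t)) ∘ φ) (Iic m) := by
      intro t ht
      have ht' : (t : ℝ) ≤ 1 / 2 := ht
      simp only [F, φ, Path.trans_apply, ht', dif_pos, Function.comp]
      congr
      have := t.2.1
      rw [min_eq_right (by linarith), max_eq_right (by linarith)]
    rw [eVariationOn.congr this]
    exact eVariationOn.comp_le_of_monotoneOn _ φ
      (fun x _ y _ h => monotone_projIcc _ (by gcongr)) (mapsTo_univ _ _)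
  · let φ : unitInterval → unitInterval := fun t => projIcc 0 1 zero_le_one (2 * (t : ℝ) - 1)
    have : EqOn F ((fun t => reebFun f (γ' t)) ∘ φ) (Ici m) := by
      intro t ht
      have ht' : 1 / 2 ≤ (t : ℝ) := ht
      simp only [F, φ, Path.trans_apply, Function.comp]
      split_ifs with h
      · have : (t : ℝ) = 1 / 2 := le_antisymm h ht'
        have h2 : projIcc 0 1 zero_le_one (2 * (t : ℝ) - 1) = (0 : unitInterval) := by
          rw [this]; norm_num
        rw [h2, γ'.source]
        congr
        convert γ.target
        simp [this]
      · congr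
        have := t.2.2
        rw [min_eq_right (by linarith), max_eq_right (by linarith)]
    rw [eVariationOn.congr this]
    exact eVariationOn.comp_le_of_monotoneOn _ φ
      (fun x _ y _ h => monotone_projIcc _ (by gcongr)) (mapsTo_univ _ _)

open scoped Topology in
/-- A function on the Reeb graph whose increments are locally dominated by those of the height
is `1`-Lipschitz for the intrinsic distance. -/
theorem ofReal_sub_le_reebEDist {r : ReebGraph f → ℝ}
    (h : ∀ a, ∀ᶠ b in 𝓝 a, |r b - r a| ≤ |reebFun f b - reebFun f a|) (a b : ReebGraph f) :
    ENNReal.ofReal (r b - r a) ≤ reebEDist f a b := by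
  refine le_iInf fun γ => ?_
  have := ofReal_sub_le_eVariationOn_of_eventually (g := fun t => r (γ t))
    (u := fun t => reebFun f (γ t)) fun t => (γ.continuous.tendsto t).eventually (h (γ t))
  simpa using this

end ReebEDist

/-! ### Arc decompositions and their subdivision -/

/-- A decomposition of a topological space into finitely many vertices and open arcs. -/
structure ArcGraph (R : Type*) [TopologicalSpace R] where
  V : Finset R
  J : Type
  fintype : Fintype J
  lo : J → ℝ
  hi : J → ℝ
  lo_lt_hi : ∀ j, lo j < hi j
  arc : J → ℝ → R
  continuousOn_arc : ∀ j, ContinuousOn (arc j) (Icc (lo j) (hi j))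
  injOn_arc : ∀ j, InjOn (arc j) (Icc (lo j) (hi j))
  arc_lo_mem : ∀ j, arc j (lo j) ∈ V
  arc_hi_mem : ∀ j, arc j (hi j) ∈ V
  arc_notMem : ∀ j, ∀ t ∈ Ioo (lo j) (hi j), arc j t ∉ V
  isOpen_arc : ∀ j, IsOpen (arc j '' Ioo (lo j) (hi j))
  disjoint_arc : Pairwise fun i j =>
    Disjoint (arc i '' Ioo (lo i) (hi i)) (arc j '' Ioo (lo j) (hi j))
  cover : ∀ q, q ∈ V ∨ ∃ j, ∃ t ∈ Ioo (lo j) (hi j), arc j t = q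

namespace ArcGraph

attribute [instance] ArcGraph.fintype

variable {R : Type*} [TopologicalSpace R]

/-- Transport along a homeomorphism. -/
def map {S : Type*} [TopologicalSpace S] (G : ArcGraph R) (e : R ≃ₜ S) : ArcGraph S where
  V := G.V.map e.toEquiv.toEmbedding
  J := G.J
  fintype := G.fintype
  lo := G.lo
  hi := G.hi
  lo_lt_hi := G.lo_lt_hi
  arc j t := e (G.arc j t)
  continuousOn_arc j := e.continuous.comp_continuousOn (G.continuousOn_arc j)
  injOn_arc j := e.injective.comp_injOn (G.injOn_arc j)
  arc_lo_mem j := Finset.mem_map_of_mem _ (G.arc_lo_mem j)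
  arc_hi_mem j := Finset.mem_map_of_mem _ (G.arc_hi_mem j)
  arc_notMem j t ht := fun h => G.arc_notMem j t ht ((Finset.mem_map' _).1 h)
  isOpen_arc j := by
    have := e.isOpenMap _ (G.isOpen_arc j)
    rwa [image_image] at this
  disjoint_arc i j hij := by
    have := (disjoint_image_iff e.injective).2 (G.disjoint_arc hij)
    rwa [image_image, image_image] at this
  cover q := by
    rcases G.cover (e.symm q) with h | ⟨j, t, ht, h⟩
    · exact Or.inl (Finset.mem_map.2 ⟨_, h, by simp⟩)
    · exact Or.inr ⟨j, t, ht, by simp [h]⟩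

variable [T2Space R]

theorem isClosed_arc (G : ArcGraph R) (j : G.J) {a b : ℝ} (h : Icc a b ⊆ Icc (G.lo j) (G.hi j)) :
    IsClosed (G.arc j '' Icc a b) :=
  (isCompact_Icc.image_of_continuousOn ((G.continuousOn_arc j).mono h)).isClosed

/-- Remove from the open arc the two compact end pieces, which are closed since `R` is Hausdorff.
They are intersected with the parameter interval because `a` may exceed `hi j` and `b` may lie below
`lo j`. -/
theorem isOpen_subarc (G : ArcGraph R) (j : G.J) {a b : ℝ} (ha : G.lo j ≤ a) (hb : b ≤ G.hi j) :
    IsOpen (G.arc j '' Ioo a b) := by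
  have h1 : Icc (G.lo j) a ∩ Icc (G.lo j) (G.hi j) ⊆ Icc (G.lo j) (G.hi j) := inter_subset_right
  have hc1 : IsClosed (G.arc j '' (Icc (G.lo j) a ∩ Icc (G.lo j) (G.hi j))) :=
    ((isCompact_Icc.inter_right isClosed_Icc).image_of_continuousOn
      ((G.continuousOn_arc j).mono h1)).isClosed
  have hc2 : IsClosed (G.arc j '' (Icc b (G.hi j) ∩ Icc (G.lo j) (G.hi j))) :=
    ((isCompact_Icc.inter_right isClosed_Icc).image_of_continuousOn
      ((G.continuousOn_arc j).mono inter_subset_right)).isClosed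
  have : G.arc j '' Ioo a b = (G.arc j '' Ioo (G.lo j) (G.hi j)) \
      (G.arc j '' (Icc (G.lo j) a ∩ Icc (G.lo j) (G.hi j)) ∪
        G.arc j '' (Icc b (G.hi j) ∩ Icc (G.lo j) (G.hi j))) := by
    ext q
    constructor
    · rintro ⟨t, ⟨hat, htb⟩, rfl⟩
      have ht : t ∈ Ioo (G.lo j) (G.hi j) := ⟨ha.trans_lt hat, htb.trans_le hb⟩
      refine ⟨⟨t, ht, rfl⟩, ?_⟩
      rintro (⟨s, ⟨hs1, hs2⟩, hs⟩ | ⟨s, ⟨hs1, hs2⟩, hs⟩)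
      · rw [G.injOn_arc j hs2 (Ioo_subset_Icc_self ht) hs] at hs1
        exact hs1.2.not_gt hat
      · rw [G.injOn_arc j hs2 (Ioo_subset_Icc_self ht) hs] at hs1
        exact hs1.1.not_gt htb
    · rintro ⟨⟨t, ht, rfl⟩, hn⟩
      refine ⟨t, ⟨?_, ?_⟩, rfl⟩
      · by_contra hlt
        exact hn (Or.inl ⟨t, ⟨⟨ht.1.le, not_lt.1 hlt⟩, Ioo_subset_Icc_self ht⟩, rfl⟩)
      · by_contra hlt
        exact hn (Or.inr ⟨t, ⟨⟨not_lt.1 hlt, ht.2.le⟩, Ioo_subset_Icc_self ht⟩, rfl⟩)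
  rw [this]
  exact (G.isOpen_arc j).sdiff (hc1.union hc2)

/-- Subdivision of an arc at an interior point. -/
noncomputable def subdivide [DecidableEq R] (G : ArcGraph R) [DecidableEq G.J] (j₀ : G.J) (t₀ : ℝ)
    (ht₀ : t₀ ∈ Ioo (G.lo j₀) (G.hi j₀)) : ArcGraph R :=
  -- The index `none` is the new upper piece `[t₀, hi j₀]`, while `some j₀` is truncated to `[lo j₀,
  -- t₀]`; `par` gives the arc a piece comes from.
  let lo' : Option G.J → ℝ := fun i => i.elim t₀ G.lo
  let hi' : Option G.J → ℝ := fun i => i.elim (G.hi j₀) fun j => if j = j₀ then t₀ else G.hi j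
  let par : Option G.J → G.J := fun i => i.elim j₀ id
  have hlo : ∀ i, G.lo (par i) ≤ lo' i := by
    rintro (_ | j)
    exacts [ht₀.1.le, le_rfl]
  have hhi : ∀ i, hi' i ≤ G.hi (par i) := by
    rintro (_ | j)
    · exact le_rfl
    · by_cases h : j = j₀
      · subst h; simpa [hi', par] using ht₀.2.le
      · simp [hi', par, h]
  have hIoo : ∀ i, Ioo (lo' i) (hi' i) ⊆ Ioo (G.lo (par i)) (G.hi (par i)) := fun i =>
    Ioo_subset_Ioo (hlo i) (hhi i)
  have hIcc : ∀ i, Icc (lo' i) (hi' i) ⊆ Icc (G.lo (par i)) (G.hi (par i)) := fun i =>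
    Icc_subset_Icc (hlo i) (hhi i)
  have hne : ∀ i, t₀ ∉ Ioo (lo' i) (hi' i) ∨ par i ≠ j₀ := by
    rintro (_ | j)
    · simp [lo']
    · by_cases h : j = j₀
      · simp [hi', h]
      · exact Or.inr h
  { V := insert (G.arc j₀ t₀) G.V
    J := Option G.J
    fintype := inferInstance
    lo := lo'
    hi := hi'
    lo_lt_hi := by
      rintro (_ | j)
      · exact ht₀.2
      · by_cases h : j = j₀
        · subst h; simpa [hi', lo'] using ht₀.1
        · simpa [hi', lo', h] using G.lo_lt_hi j
    arc := fun i => G.arc (par i)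
    continuousOn_arc := fun i => (G.continuousOn_arc _).mono (hIcc i)
    injOn_arc := fun i => (G.injOn_arc _).mono (hIcc i)
    arc_lo_mem := by
      rintro (_ | j)
      · exact Finset.mem_insert_self _ _
      · exact Finset.mem_insert_of_mem (G.arc_lo_mem j)
    arc_hi_mem := by
      rintro (_ | j)
      · exact Finset.mem_insert_of_mem (G.arc_hi_mem j₀)
      · by_cases h : j = j₀
        · subst h; simp [hi', par]
        · simpa [hi', par, h] using Or.inr (G.arc_hi_mem j)
    arc_notMem := by
      intro i t ht h
      rcases Finset.mem_insert.1 h with h | h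
      · have h1 : par i = j₀ := by
          by_contra hne
          exact disjoint_left.1 (G.disjoint_arc hne) ⟨t, hIoo i ht, rfl⟩ ⟨t₀, ht₀, h.symm⟩
        rw [h1] at h
        have h2 : t = t₀ := G.injOn_arc j₀ (by
          rw [← h1]; exact Ioo_subset_Icc_self (hIoo i ht)) (Ioo_subset_Icc_self ht₀) h
        rcases hne i with h3 | h3
        · exact h3 (h2 ▸ ht)
        · exact h3 h1
      · exact G.arc_notMem _ t (hIoo i ht) h
    isOpen_arc := fun i => G.isOpen_subarc _ (hlo i) (hhi i)
    disjoint_arc := by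
      intro i i' hii
      by_cases h : par i = par i'
      · rw [disjoint_left]
        rintro _ ⟨t, ht, rfl⟩ ⟨s, hs, hst⟩
        have h2 : s = t := G.injOn_arc (par i) (by
          rw [h]; exact Ioo_subset_Icc_self (hIoo i' hs)) (Ioo_subset_Icc_self (hIoo i ht))
          (by rw [← hst, h])
        subst h2
        rcases i with _ | j <;> rcases i' with _ | j'
        · exact hii rfl
        · have h : j₀ = j' := h
          subst h
          simp [lo', hi'] at ht hs
          linarith
        · have h : j = j₀ := h
          subst h
          simp [lo', hi'] at ht hs
          linarith
        · exact hii (congrArg some h)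
      · exact (G.disjoint_arc h).mono (image_mono (hIoo i)) (image_mono (hIoo i'))
    cover := by
      intro q
      rcases G.cover q with h | ⟨j, t, ht, rfl⟩
      · exact Or.inl (Finset.mem_insert_of_mem h)
      · by_cases h : j = j₀
        · subst h
          rcases lt_trichotomy t t₀ with h | h | h
          · exact Or.inr ⟨some j, t, ⟨ht.1, by simpa [hi'] using h⟩, rfl⟩
          · exact Or.inl (h ▸ Finset.mem_insert_self _ _)
          · exact Or.inr ⟨none, t, ⟨h, ht.2⟩, rfl⟩
        · exact Or.inr ⟨some j, t, ⟨ht.1, by simpa [hi', h] using ht.2⟩, rfl⟩ }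

theorem exists_refinement (G : ArcGraph R) (F : Finset R) :
    ∃ G' : ArcGraph R, G.V ⊆ G'.V ∧ F ⊆ G'.V := by
  classical
  induction F using Finset.induction_on with
  | empty => exact ⟨G, Finset.Subset.refl _, Finset.empty_subset _⟩
  | insert q F _ ih =>
    obtain ⟨G', h1, h2⟩ := ih
    rcases G'.cover q with h | ⟨j, t, ht, rfl⟩
    · exact ⟨G', h1, Finset.insert_subset h h2⟩
    · refine ⟨G'.subdivide j t ht, h1.trans (Finset.subset_insert _ _),
        Finset.insert_subset (Finset.mem_insert_self _ _) (h2.trans (Finset.subset_insert _ _))⟩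

end ArcGraph

/-! ### Finite one-dimensional complexes as arc decompositions -/

section Complex

variable {E : Type*} [NormedAddCommGroup E] [NormedSpace ℝ E]

/-- Faces meet in the hull of their common vertices. If one of `u`, `v` were not common, that hull
would contain at most the other endpoint, not an interior point of the edge. -/
theorem Geometry.SimplicialComplex.eq_pair_of_lineMap_mem [DecidableEq E]
    {K : Geometry.SimplicialComplex ℝ E}
    (hdim : ∀ s ∈ K.faces, s.card ≤ 2) {u v : E} (huv : u ≠ v) (hs : {u, v} ∈ K.faces)
    {t : ℝ} (ht : t ∈ Ioo (0 : ℝ) 1) {s : Finset E} (hs' : s ∈ K.faces)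
    (hz : AffineMap.lineMap u v t ∈ convexHull ℝ (s : Set E)) : s = {u, v} := by
  have hz0 : AffineMap.lineMap u v t ∈ convexHull ℝ (({u, v} : Finset E) : Set E) := by
    rw [Finset.coe_pair, convexHull_pair, segment_eq_image_lineMap]
    exact ⟨t, Ioo_subset_Icc_self ht, rfl⟩
  have hz1 := K.inter_subset_convexHull hs hs' ⟨hz0, hz⟩
  have hu : u ∈ s := by
    by_contra hu
    have h1 : ((({u, v} : Finset E) : Set E) ∩ s : Set E) ⊆ {v} := by
      rintro x ⟨hx, hxs⟩
      simp only [Finset.coe_pair, mem_insert_iff, mem_singleton_iff] at hx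
      rcases hx with rfl | rfl
      · exact absurd hxs hu
      · rfl
    have h2 := convexHull_mono h1 hz1
    rw [convexHull_singleton, mem_singleton_iff, AffineMap.lineMap_eq_right_iff] at h2
    exact h2.elim huv (fun h => ht.2.ne h)
  have hv : v ∈ s := by
    by_contra hv
    have h1 : ((({u, v} : Finset E) : Set E) ∩ s : Set E) ⊆ {u} := by
      rintro x ⟨hx, hxs⟩
      simp only [Finset.coe_pair, mem_insert_iff, mem_singleton_iff] at hx
      rcases hx with rfl | rfl
      · rfl
      · exact absurd hxs hv
    have h2 := convexHull_mono h1 hz1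
    rw [convexHull_singleton, mem_singleton_iff, AffineMap.lineMap_eq_left_iff] at h2
    exact h2.elim huv (fun h => ht.1.ne' h)
  refine (Finset.eq_of_subset_of_card_le ?_ ?_).symm
  · simp [Finset.insert_subset_iff, hu, hv]
  · rw [Finset.card_pair huv]
    exact hdim s hs'

theorem Geometry.SimplicialComplex.nonempty_arcGraph {n : ℕ}
    (K : Geometry.SimplicialComplex ℝ (EuclideanSpace ℝ (Fin n)))
    (hfin : K.faces.Finite) (hdim : ∀ s ∈ K.faces, s.card ≤ 2) : Nonempty (ArcGraph K.space) := by
  classical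
  let J : Type := {s : Finset (EuclideanSpace ℝ (Fin n)) // s ∈ K.faces ∧ s.card = 2}
  have hJ : Finite J := (hfin.subset (fun s hs => hs.1) :
    {s : Finset (EuclideanSpace ℝ (Fin n)) | s ∈ K.faces ∧ s.card = 2}.Finite)
  choose a b hab hJab using fun j : J => Finset.card_eq_two.1 j.2.2
  have hface : ∀ j : J, {a j, b j} ∈ K.faces := fun j => hJab j ▸ j.2.1
  have hspace : ∀ (j : J) (t : ℝ), t ∈ Icc (0 : ℝ) 1 →
      AffineMap.lineMap (a j) (b j) t ∈ K.space := fun j t ht => by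
    refine K.convexHull_subset_space (hface j) ?_
    rw [Finset.coe_pair, convexHull_pair, segment_eq_image_lineMap]
    exact ⟨t, ht, rfl⟩
  let arc : J → ℝ → K.space := fun j t =>
    ⟨AffineMap.lineMap (a j) (b j) (projIcc (0 : ℝ) 1 zero_le_one t : ℝ),
      hspace j _ (projIcc (0 : ℝ) 1 zero_le_one t).2⟩
  have harc : ∀ j, ∀ t ∈ Icc (0 : ℝ) 1, (arc j t : EuclideanSpace ℝ (Fin n)) =
      AffineMap.lineMap (a j) (b j) t := fun j t ht => by
    simp only [arc, projIcc_of_mem zero_le_one ht]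
  have hcont : ∀ j, Continuous (arc j) := fun j => by
    refine Continuous.subtype_mk ?_ _
    exact (AffineMap.lineMap_continuous).comp
      (continuous_subtype_val.comp continuous_projIcc)
  have hvf : {x : K.space | ({(x : EuclideanSpace ℝ (Fin n))} : Finset _) ∈ K.faces}.Finite := by
    refine (hfin.preimage (f := fun x : K.space => ({(x : EuclideanSpace ℝ (Fin n))} : Finset _))
      fun x _ y _ h => ?_)
    exact Subtype.ext (Finset.singleton_injective h)
  have key : ∀ j, ∀ t ∈ Ioo (0 : ℝ) 1, ∀ s ∈ K.faces,
      (arc j t : EuclideanSpace ℝ (Fin n)) ∈ convexHull ℝ (s : Set (EuclideanSpace ℝ (Fin n))) →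
        s = j.1 := fun j t ht s hs h => by
    rw [hJab j]
    rw [harc j t (Ioo_subset_Icc_self ht)] at h
    exact K.eq_pair_of_lineMap_mem hdim (hab j) (hface j) ht hs h
  have hmem : ∀ j, ∀ t ∈ Icc (0 : ℝ) 1, (arc j t : EuclideanSpace ℝ (Fin n)) ∈
      convexHull ℝ (j.1 : Set (EuclideanSpace ℝ (Fin n))) := fun j t ht => by
    rw [harc j t ht, hJab j, Finset.coe_pair, convexHull_pair, segment_eq_image_lineMap]
    exact ⟨t, ht, rfl⟩
  have hsing : ∀ j, {a j} ∈ K.faces ∧ {b j} ∈ K.faces := fun j =>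
    ⟨K.down_closed (hface j) (by simp) (by simp), K.down_closed (hface j) (by simp) (by simp)⟩
  have hcases : ∀ q : K.space, q ∈ hvf.toFinset ∨ ∃ j, ∃ t ∈ Ioo (0 : ℝ) 1, arc j t = q := by
    rintro ⟨q, hq⟩
    obtain ⟨s, hs, hqs⟩ := Geometry.SimplicialComplex.mem_space_iff.1 hq
    have h0 : s.card ≠ 0 := fun h => by
      rw [Finset.card_eq_zero] at h
      exact K.empty_notMem (h ▸ hs)
    have h2 := hdim s hs
    have : s.card = 1 ∨ s.card = 2 := by omega
    rcases this with h | h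
    · obtain ⟨x, rfl⟩ := Finset.card_eq_one.1 h
      left
      simp only [Finset.coe_singleton, convexHull_singleton, mem_singleton_iff] at hqs
      subst hqs
      simpa using hs
    · let j : J := ⟨s, hs, h⟩
      have hjs : s = {a j, b j} := hJab j
      rw [hjs, Finset.coe_pair, convexHull_pair, segment_eq_image_lineMap] at hqs
      obtain ⟨t, ht, rfl⟩ := hqs
      rcases eq_or_lt_of_le ht.1 with h0 | h0
      · left
        subst h0
        simpa using (hsing j).1
      · rcases eq_or_lt_of_le ht.2 with h1 | h1
        · left
          subst h1
          simpa using (hsing j).2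
        · exact Or.inr ⟨j, t, ⟨h0, h1⟩, Subtype.ext (harc j t ht)⟩
  have hnot : ∀ j, ∀ t ∈ Ioo (0 : ℝ) 1, arc j t ∉ hvf.toFinset := fun j t ht h => by
    have h1 := key j t ht _ ((Set.Finite.mem_toFinset hvf).1 h) (by simp)
    have h2 := j.2.2
    rw [← h1] at h2
    simp at h2
  exact ⟨{
    V := hvf.toFinset
    J := J
    fintype := Fintype.ofFinite J
    lo := fun _ => 0
    hi := fun _ => 1
    lo_lt_hi := fun _ => zero_lt_one
    arc := arc
    continuousOn_arc := fun j => (hcont j).continuousOn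
    injOn_arc := fun j s hs t ht h => by
      have h1 := congrArg Subtype.val h
      rw [harc j s hs, harc j t ht] at h1
      exact AffineMap.lineMap_injective ℝ (hab j) h1
    arc_lo_mem := fun j => by
      rw [Set.Finite.mem_toFinset]
      show {(arc j 0 : EuclideanSpace ℝ (Fin n))} ∈ K.faces
      rw [harc j 0 (by simp)]
      simpa using (hsing j).1
    arc_hi_mem := fun j => by
      rw [Set.Finite.mem_toFinset]
      show {(arc j 1 : EuclideanSpace ℝ (Fin n))} ∈ K.faces
      rw [harc j 1 (by simp)]
      simpa using (hsing j).2
    arc_notMem := hnot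
    isOpen_arc := fun j => by
      -- An open edge is the complement of the finite union of all other closed faces.
      have hcl : IsClosed (⋃ s ∈ {s | s ∈ K.faces ∧ s ≠ j.1},
          {q : K.space | (q : EuclideanSpace ℝ (Fin n)) ∈
            convexHull ℝ (s : Set (EuclideanSpace ℝ (Fin n)))}) := by
        refine (hfin.subset fun s hs => hs.1).isClosed_biUnion fun s _ => ?_
        exact (s.finite_toSet.isClosed_convexHull ℝ).preimage continuous_subtype_val
      convert hcl.isOpen_compl using 1
      ext q
      simp only [mem_compl_iff, mem_iUnion, not_exists, mem_ofPred_eq, mem_image]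
      constructor
      · rintro ⟨t, ht, rfl⟩ s ⟨hs, hne⟩ h
        exact hne (key j t ht s hs h)
      · intro h
        rcases hcases q with hq | ⟨i, t, ht, rfl⟩
        · exfalso
          refine h _ ⟨(Set.Finite.mem_toFinset hvf).1 hq, fun h1 => ?_⟩ (by simp)
          have h2 := j.2.2
          rw [← h1] at h2
          simp at h2
        · refine ⟨t, ht, ?_⟩
          by_contra hne
          have hij : i ≠ j := fun h => hne (by rw [h])
          exact h i.1 ⟨i.2.1, fun h => hij (Subtype.ext h)⟩ (hmem i t (Ioo_subset_Icc_self ht))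
    disjoint_arc := fun i j hij => by
      refine disjoint_left.2 ?_
      rintro _ ⟨t, ht, rfl⟩ ⟨s, hs, h⟩
      refine hij (Subtype.ext (key j s hs i.1 i.2.1 ?_))
      rw [h]
      exact hmem i t (Ioo_subset_Icc_self ht)
    cover := hcases }⟩

end Complex

/-! ### Making the arcs monotone for the height -/

namespace ArcGraph

variable {R : Type*} [TopologicalSpace R]

/-- The arcs are parametrised by the values of `h`. -/
def IsHeight (G : ArcGraph R) (h : R → ℝ) : Prop :=
  ∀ j, ∀ t ∈ Icc (G.lo j) (G.hi j), h (G.arc j t) = t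

variable [T2Space R]

open scoped Topology in
theorem image_mem_nhds (G : ArcGraph R) (j : G.J) {t : ℝ} (ht : t ∈ Ioo (G.lo j) (G.hi j))
    {W : Set ℝ} (hW : W ∈ 𝓝 t) : G.arc j '' W ∈ 𝓝 (G.arc j t) := by
  obtain ⟨a, b, hab, hsub⟩ := mem_nhds_iff_exists_Ioo_subset.1 hW
  refine Filter.mem_of_superset ((G.isOpen_subarc j (le_max_right a (G.lo j))
    (min_le_right b (G.hi j))).mem_nhds ⟨t, ⟨max_lt hab.1 ht.1, lt_min hab.2 ht.2⟩, rfl⟩)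
    (image_mono ((Ioo_subset_Ioo (le_max_left _ _) (min_le_left _ _)).trans hsub))

theorem isLocalMin_arc (G : ArcGraph R) {h : R → ℝ} (j : G.J) {t : ℝ}
    (ht : t ∈ Ioo (G.lo j) (G.hi j)) (hm : IsLocalMin (fun s => h (G.arc j s)) t) :
    IsLocalMin h (G.arc j t) := by
  refine Filter.mem_of_superset (G.image_mem_nhds j ht hm) ?_
  rintro _ ⟨s, hs, rfl⟩
  exact hs

theorem isLocalMax_arc (G : ArcGraph R) {h : R → ℝ} (j : G.J) {t : ℝ}
    (ht : t ∈ Ioo (G.lo j) (G.hi j)) (hm : IsLocalMax (fun s => h (G.arc j s)) t) :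
    IsLocalMax h (G.arc j t) := by
  refine Filter.mem_of_superset (G.image_mem_nhds j ht hm) ?_
  rintro _ ⟨s, hs, rfl⟩
  exact hs

end ArcGraph

open scoped Topology in
/-- A continuous function without local minima on an open interval has at most one local maximum
there. -/
theorem eq_of_isLocalMax_of_forall_not_isLocalMin {g : ℝ → ℝ} {a b : ℝ}
    (hg : ContinuousOn g (Ioo a b)) (hmin : ∀ t ∈ Ioo a b, ¬IsLocalMin g t) {s t : ℝ}
    (hs : s ∈ Ioo a b) (ht : t ∈ Ioo a b) (hms : IsLocalMax g s) (hmt : IsLocalMax g t) :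
    s = t := by
  wlog hst : s < t generalizing s t
  · rcases lt_or_eq_of_le (not_lt.1 hst) with h | h
    · exact (this ht hs hmt hms h).symm
    · exact h.symm
  exfalso
  have hsub : Icc s t ⊆ Ioo a b := fun x hx => ⟨hs.1.trans_le hx.1, hx.2.trans_lt ht.2⟩
  have hIoo : ∀ x ∈ Ioo s t, ¬ ∀ y ∈ Icc s t, g x ≤ g y := fun x hx hle =>
    hmin x (hsub (Ioo_subset_Icc_self hx)) (Filter.mem_of_superset (Icc_mem_nhds hx.1 hx.2) hle)
  obtain ⟨m, hm, hmle⟩ := isCompact_Icc.exists_isMinOn (nonempty_Icc.2 hst.le) (hg.mono hsub)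
  have hmle' : ∀ y ∈ Icc s t, g m ≤ g y := fun y hy => hmle hy
  -- If the minimum over `[s, t]` is at an endpoint, that endpoint is also a local maximum, so
  -- nearby interior points attain the minimum as well.
  rcases eq_or_lt_of_le hm.1 with rfl | h1
  · obtain ⟨x, hx, hxI⟩ := (((hms.filter_mono nhdsWithin_le_nhds : ∀ᶠ x in 𝓝[>] s, g x ≤ g s)).and
      (Ioo_mem_nhdsGT hst)).exists
    exact hIoo x hxI fun y hy => hx.trans (hmle' y hy)
  · rcases eq_or_lt_of_le hm.2 with rfl | h2
    · obtain ⟨x, hx, hxI⟩ := (((hmt.filter_mono nhdsWithin_le_nhds :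
        ∀ᶠ x in 𝓝[<] m, g x ≤ g m)).and (Ioo_mem_nhdsLT hst)).exists
      exact hIoo x hxI fun y hy => hx.trans (hmle' y hy)
    · exact hIoo m ⟨h1, h2⟩ hmle'

/-- A right inverse of a continuous function with values in a compact set on which the function is
injective is continuous. -/
theorem continuousOn_of_isCompact_of_rightInverse {R : Type*} [TopologicalSpace R]
    {h : R → ℝ} (hc : Continuous h) {A : Set R} (hA : IsCompact A) (hinj : InjOn h A)
    {B : Set ℝ} {s : ℝ → R} (hs : MapsTo s B A) (hinv : ∀ t ∈ B, h (s t) = t) :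
    ContinuousOn s B := by
  refine continuousOn_iff_isClosed.2 fun C hC => ⟨h '' (A ∩ C),
    ((hA.inter_right hC).image hc).isClosed, ?_⟩
  ext t
  constructor
  · rintro ⟨h1, h2⟩
    exact ⟨⟨s t, ⟨hs h2, h1⟩, hinv t h2⟩, h2⟩
  · rintro ⟨⟨q, ⟨hqA, hqC⟩, hq⟩, h2⟩
    refine ⟨?_, h2⟩
    rw [hinj hqA (hs h2) (by rw [hq, hinv t h2])] at hqC
    exact hqC

theorem exists_reparam_of_strictMonoOn {R : Type*} [TopologicalSpace R] {h : R → ℝ}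
    (hc : Continuous h) {arc : ℝ → R} {a b : ℝ} (hab : a < b)
    (harc : ContinuousOn arc (Icc a b)) (hmono : StrictMonoOn (fun t => h (arc t)) (Icc a b)) :
    ∃ (a' b' : ℝ) (arc' : ℝ → R), a' < b' ∧ ContinuousOn arc' (Icc a' b') ∧
      (∀ t ∈ Icc a' b', h (arc' t) = t) ∧ arc' '' Ioo a' b' = arc '' Ioo a b ∧
      arc' a' = arc a ∧ arc' b' = arc b := by
  have ha : a ∈ Icc a b := left_mem_Icc.2 hab.le
  have hb : b ∈ Icc a b := right_mem_Icc.2 hab.le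
  have hg : ContinuousOn (fun t => h (arc t)) (Icc a b) := hc.comp_continuousOn harc
  have hsurj : ∀ t ∈ Icc (h (arc a)) (h (arc b)), ∃ s ∈ Icc a b, h (arc s) = t :=
    fun t ht => intermediate_value_Icc hab.le hg ht
  let inv : ℝ → ℝ := Function.invFunOn (fun t => h (arc t)) (Icc a b)
  have hinv : ∀ s ∈ Icc a b, inv (h (arc s)) = s := fun s hs =>
    hmono.injOn.leftInvOn_invFunOn hs
  have hinv' : ∀ t ∈ Icc (h (arc a)) (h (arc b)), inv t ∈ Icc a b ∧ h (arc (inv t)) = t :=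
    fun t ht => ⟨Function.invFunOn_mem (hsurj t ht), Function.invFunOn_eq (hsurj t ht)⟩
  refine ⟨h (arc a), h (arc b), fun t => arc (inv t), hmono ha hb hab, ?_,
    fun t ht => (hinv' t ht).2, ?_, by simp only [hinv a ha], by simp only [hinv b hb]⟩
  · refine continuousOn_of_isCompact_of_rightInverse hc (isCompact_Icc.image_of_continuousOn harc)
      ?_ (fun t ht => ⟨_, (hinv' t ht).1, rfl⟩) fun t ht => (hinv' t ht).2
    rintro _ ⟨s, hs, rfl⟩ _ ⟨t, ht, rfl⟩ hst
    rw [hmono.injOn hs ht hst]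
  · ext q
    constructor
    · rintro ⟨t, ht, rfl⟩
      obtain ⟨h1, h2⟩ := hinv' t (Ioo_subset_Icc_self ht)
      refine ⟨inv t, ⟨lt_of_le_of_ne h1.1 fun he => ?_, lt_of_le_of_ne h1.2 fun he => ?_⟩, rfl⟩
      · rw [← he] at h2; exact ht.1.ne h2
      · rw [he] at h2; exact ht.2.ne' h2
    · rintro ⟨s, hs, rfl⟩
      have hs' := Ioo_subset_Icc_self hs
      exact ⟨h (arc s), ⟨hmono ha hs' hs.1, hmono hs' hb hs.2⟩, by simp only [hinv s hs']⟩

theorem exists_reparam_of_injOn {R : Type*} [TopologicalSpace R] {h : R → ℝ}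
    (hc : Continuous h) {arc : ℝ → R} {a b : ℝ} (hab : a < b)
    (harc : ContinuousOn arc (Icc a b)) (hinj : InjOn (fun t => h (arc t)) (Icc a b)) :
    ∃ (a' b' : ℝ) (arc' : ℝ → R), a' < b' ∧ ContinuousOn arc' (Icc a' b') ∧
      (∀ t ∈ Icc a' b', h (arc' t) = t) ∧ arc' '' Ioo a' b' = arc '' Ioo a b ∧
      ((arc' a' = arc a ∧ arc' b' = arc b) ∨ (arc' a' = arc b ∧ arc' b' = arc a)) := by
  rcases (hc.comp_continuousOn harc).strictMonoOn_of_injOn_Icc' hab.le hinj with hm | hm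
  · obtain ⟨a', b', arc', h1, h2, h3, h4, h5⟩ := exists_reparam_of_strictMonoOn hc hab harc hm
    exact ⟨a', b', arc', h1, h2, h3, h4, Or.inl h5⟩
  -- In the decreasing case, reverse the arc by `t ↦ -t`; the endpoints are then exchanged.
  · have hneg : MapsTo (fun t : ℝ => -t) (Icc (-b) (-a)) (Icc a b) := fun t ht =>
      ⟨by linarith [ht.2], by linarith [ht.1]⟩
    obtain ⟨a', b', arc', h1, h2, h3, h4, h5⟩ := exists_reparam_of_strictMonoOn hc
      (neg_lt_neg hab) (harc.comp continuous_neg.continuousOn hneg)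
      (fun s hs t ht hst => hm (hneg ht) (hneg hs) (neg_lt_neg hst))
    refine ⟨a', b', arc', h1, h2, h3, ?_, Or.inr ?_⟩
    · rw [h4, show (arc ∘ fun t : ℝ => -t) = arc ∘ Neg.neg from rfl, image_comp]
      congr 1
      simp
    · simpa using h5

namespace ArcGraph

variable {R : Type*} [TopologicalSpace R]

theorem exists_isHeight_of_injOn (G : ArcGraph R) {h : R → ℝ} (hc : Continuous h)
    (hinj : ∀ j, InjOn (fun t => h (G.arc j t)) (Icc (G.lo j) (G.hi j))) :
    ∃ G' : ArcGraph R, G'.V = G.V ∧ G'.IsHeight h := by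
  choose lo hi arc hlt hcont hheight himage hends using fun j =>
    exists_reparam_of_injOn hc (G.lo_lt_hi j) (G.continuousOn_arc j) (hinj j)
  refine ⟨{
    V := G.V
    J := G.J
    fintype := G.fintype
    lo := lo
    hi := hi
    lo_lt_hi := hlt
    arc := arc
    continuousOn_arc := hcont
    injOn_arc := fun j s hs t ht hst => by rw [← hheight j s hs, ← hheight j t ht, hst]
    arc_lo_mem := fun j => by
      rcases hends j with h | h <;> rw [h.1]
      exacts [G.arc_lo_mem j, G.arc_hi_mem j]
    arc_hi_mem := fun j => by
      rcases hends j with h | h <;> rw [h.2]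
      exacts [G.arc_hi_mem j, G.arc_lo_mem j]
    arc_notMem := fun j t ht => by
      obtain ⟨s, hs, h⟩ := (himage j).subset ⟨t, ht, rfl⟩
      rw [← h]
      exact G.arc_notMem j s hs
    isOpen_arc := fun j => by
      rw [himage]
      exact G.isOpen_arc j
    disjoint_arc := fun i j hij => by
      simpa only [himage] using G.disjoint_arc hij
    cover := fun q => by
      rcases G.cover q with hq | ⟨j, t, ht, h⟩
      · exact Or.inl hq
      · exact Or.inr ⟨j, (himage j).superset ⟨t, ht, h⟩⟩ }, rfl, hheight⟩

/-- If `h` has no local minimum apart from `q₀`, the arcs may be taken monotone for `h`. -/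
theorem exists_isHeight [T2Space R] (G : ArcGraph R) {h : R → ℝ} (hc : Continuous h) (q₀ : R)
    (hmin : ∀ q, q ≠ q₀ → ¬IsLocalMin h q) (F : Finset R) :
    ∃ G' : ArcGraph R, G'.IsHeight h ∧ q₀ ∈ G'.V ∧ F ⊆ G'.V := by
  classical
  obtain ⟨G₁, -, hG₁⟩ := G.exists_refinement {q₀}
  rw [Finset.singleton_subset_iff] at hG₁
  have hm : ∀ j : G₁.J, ∃ m : ℝ, ∀ t ∈ Ioo (G₁.lo j) (G₁.hi j),
      IsLocalMax (fun s => h (G₁.arc j s)) t → t = m := by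
    intro j
    by_cases hex : ∃ m ∈ Ioo (G₁.lo j) (G₁.hi j), IsLocalMax (fun s => h (G₁.arc j s)) m
    · obtain ⟨m, hmI, hm⟩ := hex
      refine ⟨m, fun t ht hmax => eq_of_isLocalMax_of_forall_not_isLocalMin
        (hc.comp_continuousOn ((G₁.continuousOn_arc j).mono Ioo_subset_Icc_self))
        (fun s hs hs' => ?_) ht hmI hmax hm⟩
      refine hmin (G₁.arc j s) (fun he => G₁.arc_notMem j s hs (by rwa [he])) (G₁.isLocalMin_arc j hs hs')
    · push Not at hex
      -- Without a local maximum the value of `m` is arbitrary: it only adds a harmless vertex.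
      exact ⟨0, fun t ht hmax => absurd hmax (hex t ht)⟩
  choose m hm using hm
  obtain ⟨G₂, hG₂, hF⟩ := G₁.exists_refinement (F ∪ Finset.univ.image fun j => G₁.arc j (m j))
  have hmax : ∀ q ∉ G₂.V, ¬IsLocalMax h q := by
    intro q hq hqm
    rcases G₁.cover q with hq1 | ⟨j, t, ht, rfl⟩
    · exact hq (hG₂ hq1)
    · have hct : ContinuousAt (G₁.arc j) t :=
        (G₁.continuousOn_arc j).continuousAt (Icc_mem_nhds ht.1 ht.2)
      have := hm j t ht (hct.tendsto.eventually hqm)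
      refine hq (hF (Finset.mem_union_right _ ?_))
      rw [this]
      exact Finset.mem_image_of_mem _ (Finset.mem_univ j)
  obtain ⟨G₃, hV, hG₃⟩ := G₂.exists_isHeight_of_injOn hc (by
    intro j
    have key : ∀ s ∈ Icc (G₂.lo j) (G₂.hi j), ∀ t ∈ Icc (G₂.lo j) (G₂.hi j), s < t →
        h (G₂.arc j s) ≠ h (G₂.arc j t) := by
      intro s hs t ht hst he
      have hsub : Icc s t ⊆ Icc (G₂.lo j) (G₂.hi j) := Icc_subset_Icc hs.1 ht.2
      -- Rolle: equal values at two parameters would force an extremum strictly inside an arc, and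
      -- all extrema are now vertices.
      obtain ⟨x, hx, hext⟩ := exists_isLocalExtr_Ioo (f := fun t => h (G₂.arc j t)) hst
        (hc.comp_continuousOn ((G₂.continuousOn_arc j).mono hsub)) he
      have hx' : x ∈ Ioo (G₂.lo j) (G₂.hi j) := ⟨hs.1.trans_lt hx.1, hx.2.trans_le ht.2⟩
      rcases hext with hext | hext
      · exact hmin (G₂.arc j x) (fun he => G₂.arc_notMem j x hx' (by rw [he]; exact hG₂ hG₁))
          (G₂.isLocalMin_arc j hx' hext)
      · exact hmax _ (G₂.arc_notMem j x hx') (G₂.isLocalMax_arc j hx' hext)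
    intro s hs t ht he
    rcases lt_trichotomy s t with h1 | h1 | h1
    · exact absurd he (key s hs t ht h1)
    · exact h1
    · exact absurd he.symm (key t ht s hs h1))
  exact ⟨G₃, hG₃, hV ▸ hG₂ hG₁, hV ▸ (Finset.subset_union_left.trans hF)⟩

end ArcGraph

/-! ### Connected preimages and geodesics towards the base point -/

/-- Over an open set `φ` is still a quotient map, and a quotient map with connected fibres pulls
connectedness back. -/
theorem isConnected_preimage_of_isOpen {X R : Type*} [TopologicalSpace X] [TopologicalSpace R]
    {φ : X → R} (hφ : Topology.IsQuotientMap φ) (hfib : ∀ a, IsPreconnected (φ ⁻¹' {a}))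
    {W : Set R} (hW : IsOpen W) (hWc : IsConnected W) : IsConnected (φ ⁻¹' W) := by
  have hq := hφ.restrictPreimage_isOpen hW
  have : ConnectedSpace W := isConnected_iff_connectedSpace.1 hWc
  have h1 := hq.isCoinducing.isConnected_preimage_of_isClosed (t := univ) (fun a => by
    obtain ⟨x, hx⟩ := hq.surjective a
    refine ⟨⟨x, hx⟩, ?_⟩
    rw [← Topology.IsInducing.subtypeVal.isPreconnected_image]
    convert hfib a using 1
    ext y
    constructor
    · rintro ⟨⟨y, hy⟩, h, rfl⟩
      exact congrArg Subtype.val (show W.restrictPreimage φ ⟨y, hy⟩ = a from h)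
    · intro h
      have h' : φ y = a := h
      exact ⟨⟨y, by rw [mem_preimage, h']; exact a.2⟩, Subtype.ext h', rfl⟩) isClosed_univ
    isConnected_univ
  rw [preimage_univ] at h1
  exact isConnected_iff_connectedSpace.2 (connectedSpace_iff_univ.2 h1)

section Geodesic

variable {X : Type*} [MetricSpace X]

theorem IsGeodesicSpace.exists_path (hX : IsGeodesicSpace X) (x y : X) :
    ∃ γ : Path x y, ∀ s t, dist (γ s) (γ t) = dist x y * |(s : ℝ) - t| := by
  obtain ⟨γ, h0, h1, hγ⟩ := hX x y
  have hmem : ∀ t : unitInterval, (t : ℝ) * dist x y ∈ Icc 0 (dist x y) := fun t =>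
    ⟨mul_nonneg t.2.1 dist_nonneg, mul_le_of_le_one_left dist_nonneg t.2.2⟩
  have hd : ∀ s t : unitInterval, dist (γ (s * dist x y)) (γ (t * dist x y)) =
      dist x y * |(s : ℝ) - t| := fun s t => by
    rw [hγ _ (hmem s) _ (hmem t), ← sub_mul, abs_mul, abs_of_nonneg (dist_nonneg (x := x)), mul_comm]
  refine ⟨⟨⟨fun t => γ (t * dist x y), ?_⟩, by simp [h0], by simp [h1]⟩, hd⟩
  refine (LipschitzWith.of_dist_le_mul (K := ⟨dist x y, dist_nonneg⟩) fun s t => ?_).continuous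
  rw [hd, Subtype.dist_eq, Real.dist_eq]
  rfl

theorem IsGeodesicSpace.locallyPathConnectedSpace (hX : IsGeodesicSpace X) :
    LocallyPathConnectedSpace X := by
  refine .of_bases (fun x => Metric.nhds_basis_ball) fun x r hr =>
    ⟨x, Metric.mem_ball_self hr, fun {y} hy => ?_⟩
  obtain ⟨γ, hγ⟩ := hX.exists_path x y
  refine ⟨γ, fun t => ?_⟩
  have h1 := hγ t 0
  rw [γ.source] at h1
  rw [Metric.mem_ball, h1]
  refine lt_of_le_of_lt ?_ (Metric.mem_ball'.1 hy)
  refine mul_le_of_le_one_right dist_nonneg ?_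
  simpa [abs_of_nonneg t.2.1] using t.2.2

theorem IsGeodesicSpace.exists_descending (hX : IsGeodesicSpace X) (p x : X) :
    ∃ γ : ℝ → X, γ 0 = x ∧ ContinuousOn γ (Icc 0 (dist p x)) ∧
      ∀ s ∈ Icc 0 (dist p x), dist p (γ s) = dist p x - s ∧ dist x (γ s) = s := by
  obtain ⟨γ, h0, h1, hγ⟩ := hX x p
  rw [dist_comm x p] at h1 hγ
  have hl : (0 : ℝ) ∈ Icc 0 (dist p x) := ⟨le_rfl, dist_nonneg⟩
  have hr : dist p x ∈ Icc 0 (dist p x) := ⟨dist_nonneg, le_rfl⟩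
  refine ⟨γ, h0, ?_, fun s hs => ⟨?_, ?_⟩⟩
  · refine (LipschitzOnWith.of_dist_le_mul (K := 1) fun s hs t ht => ?_).continuousOn
    rw [hγ s hs t ht, NNReal.coe_one, one_mul, Real.dist_eq]
  · have := hγ _ hr s hs
    rwa [h1, abs_of_nonneg (by linarith [hs.2])] at this
  · have := hγ _ hl s hs
    rwa [h0, zero_sub, abs_neg, abs_of_nonneg hs.1] at this

end Geodesic

/-! ### Descent along arcs, the spanning tree and the corank -/

/-- The quotient map `φ` of a geodesic space contracts connected subsets of the spheres centred at
`p`, and `G` is a decomposition of the quotient into arcs parametrised by the distance to `p`. -/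
structure IsRadialQuotient {X R : Type*} [MetricSpace X] [TopologicalSpace R]
    (φ : X → R) (h : R → ℝ) (p : X) (G : ArcGraph R) : Prop where
  geodesic : IsGeodesicSpace X
  quotient : Topology.IsQuotientMap φ
  fiber : ∀ a, IsPreconnected (φ ⁻¹' {a})
  height_apply : ∀ x, h (φ x) = dist p x
  continuous_height : Continuous h
  isHeight : G.IsHeight h
  base_mem : φ p ∈ G.V

namespace IsRadialQuotient

variable {X R : Type*} [MetricSpace X] [TopologicalSpace R]
  {φ : X → R} {h : R → ℝ} {p : X} {G : ArcGraph R}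

theorem height_nonneg (H : IsRadialQuotient φ h p G) (a : R) : 0 ≤ h a := by
  obtain ⟨x, rfl⟩ := H.quotient.surjective a
  rw [H.height_apply]
  exact dist_nonneg

theorem height_lo (H : IsRadialQuotient φ h p G) (j : G.J) : h (G.arc j (G.lo j)) = G.lo j :=
  H.isHeight j _ (left_mem_Icc.2 (G.lo_lt_hi j).le)

theorem height_hi (H : IsRadialQuotient φ h p G) (j : G.J) : h (G.arc j (G.hi j)) = G.hi j :=
  H.isHeight j _ (right_mem_Icc.2 (G.lo_lt_hi j).le)

theorem lo_nonneg (H : IsRadialQuotient φ h p G) (j : G.J) : 0 ≤ G.lo j :=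
  H.height_lo j ▸ H.height_nonneg _

theorem arc_hi_ne (H : IsRadialQuotient φ h p G) (j : G.J) : G.arc j (G.hi j) ≠ φ p := by
  intro he
  have h1 := H.height_hi j
  rw [he, H.height_apply, dist_self] at h1
  linarith [H.lo_nonneg j, G.lo_lt_hi j]

variable [T2Space R]

/-- Among points with height strictly between `lo j` and `hi j`, the open arc is also relatively
closed, since the closed arc adds only its ends. A connected curve at such heights cannot leave it.
-/
theorem mem_arc_of_mem_arc (H : IsRadialQuotient φ h p G) (j : G.J) {c : ℝ → R} {I : Set ℝ}
    (hI : IsPreconnected I) (hc : ContinuousOn c I)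
    (hh : ∀ s ∈ I, h (c s) ∈ Ioo (G.lo j) (G.hi j)) {s₀ : ℝ} (hs₀ : s₀ ∈ I)
    (hmem : c s₀ ∈ G.arc j '' Ioo (G.lo j) (G.hi j)) :
    c '' I ⊆ G.arc j '' Ioo (G.lo j) (G.hi j) := by
  refine IsPreconnected.subset_left_of_subset_union (G.isOpen_arc j)
    (G.isClosed_arc j Subset.rfl).isOpen_compl ?_ ?_ ⟨_, ⟨s₀, hs₀, rfl⟩, hmem⟩ (hI.image c hc)
  · exact disjoint_compl_right.mono_left (image_mono Ioo_subset_Icc_self)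
  · rintro _ ⟨s, hs, rfl⟩
    by_cases h1 : c s ∈ G.arc j '' Icc (G.lo j) (G.hi j)
    · obtain ⟨t, ht, he⟩ := h1
      left
      refine ⟨t, ?_, he⟩
      have h2 := hh s hs
      rwa [← he, H.isHeight j t ht] at h2
    · exact Or.inr h1

/-- A geodesic towards `p` that meets an arc descends along it. -/
theorem descend (H : IsRadialQuotient φ h p G) {x : X} {γ : ℝ → X} (h0 : γ 0 = x)
    (hγc : ContinuousOn γ (Icc 0 (dist p x)))
    (hγ : ∀ s ∈ Icc 0 (dist p x), dist p (γ s) = dist p x - s ∧ dist x (γ s) = s) (j : G.J)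
    (hx : dist p x ≤ G.hi j) {s₀ : ℝ} (hs₀ : s₀ ∈ Ioo 0 (dist p x - G.lo j))
    (hmem : φ (γ s₀) ∈ G.arc j '' Ioo (G.lo j) (G.hi j)) :
    φ x ∈ G.arc j '' Icc (G.lo j) (G.hi j) ∧
      ∃ z, φ z = G.arc j (G.lo j) ∧ dist x z = dist p x - G.lo j := by
  have hlo := H.lo_nonneg j
  have hlt : 0 < dist p x - G.lo j := hs₀.1.trans hs₀.2
  have hsub : Icc 0 (dist p x - G.lo j) ⊆ Icc 0 (dist p x) := Icc_subset_Icc_right (by linarith)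
  have hc : ContinuousOn (fun s => φ (γ s)) (Icc 0 (dist p x - G.lo j)) :=
    H.quotient.continuous.comp_continuousOn (hγc.mono hsub)
  have h1 := H.mem_arc_of_mem_arc j (isPreconnected_Ioo) (hc.mono Ioo_subset_Icc_self)
    (fun s hs => by
      rw [H.height_apply, (hγ s (hsub (Ioo_subset_Icc_self hs))).1]
      exact ⟨by linarith [hs.2], by linarith [hs.1]⟩) hs₀ hmem
  have h2 : (fun s => φ (γ s)) '' Icc 0 (dist p x - G.lo j) ⊆
      G.arc j '' Icc (G.lo j) (G.hi j) := by
    rw [← closure_Ioo hlt.ne]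
    refine ContinuousOn.image_closure (by rwa [closure_Ioo hlt.ne]) |>.trans ?_
    exact closure_minimal (h1.trans (image_mono Ioo_subset_Icc_self)) (G.isClosed_arc j Subset.rfl)
  refine ⟨by simpa [h0] using h2 ⟨0, left_mem_Icc.2 hlt.le, rfl⟩, γ (dist p x - G.lo j), ?_, ?_⟩
  · obtain ⟨t, ht, he⟩ := h2 ⟨_, right_mem_Icc.2 hlt.le, rfl⟩
    have h3 := H.isHeight j t ht
    rw [he] at h3
    simp only [H.height_apply, (hγ _ (hsub (right_mem_Icc.2 hlt.le))).1] at h3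
    rw [← show G.arc j t = φ (γ (dist p x - G.lo j)) from he, ← h3]
    ring_nf
  · exact (hγ _ (hsub (right_mem_Icc.2 hlt.le))).2

open scoped Topology in
-- The open arc is a neighbourhood of `φ x`, so the geodesic to `p` starts inside it and must follow
-- it to the bottom.
theorem exists_descent_of_mem_arc (H : IsRadialQuotient φ h p G) {x : X} (j : G.J) {t : ℝ}
    (ht : t ∈ Ioo (G.lo j) (G.hi j)) (hx : φ x = G.arc j t) :
    ∃ z, φ z = G.arc j (G.lo j) ∧ dist x z = t - G.lo j := by
  obtain ⟨γ, h0, hγc, hγ⟩ := H.geodesic.exists_descending p x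
  have hpx : dist p x = t := by
    rw [← H.height_apply, hx, H.isHeight j t (Ioo_subset_Icc_self ht)]
  have hlo := H.lo_nonneg j
  have hc : ContinuousWithinAt (fun s => φ (γ s)) (Icc 0 (dist p x)) 0 :=
    (H.quotient.continuous.comp_continuousOn hγc) 0 ⟨le_rfl, dist_nonneg⟩
  have hpos : 0 < t - G.lo j := by linarith [ht.1]
  have h1 : ∀ᶠ s in 𝓝[>] (0 : ℝ), φ (γ s) ∈ G.arc j '' Ioo (G.lo j) (G.hi j) := by
    have h2 : 𝓝[>] (0 : ℝ) ≤ 𝓝[Icc 0 (dist p x)] 0 := by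
      rw [← nhdsWithin_Ioc_eq_nhdsGT (show 0 < dist p x by linarith)]
      exact nhdsWithin_mono _ Ioc_subset_Icc_self
    refine (hc.mono_left h2).eventually ((G.isOpen_arc j).mem_nhds ?_)
    exact ⟨t, ht, by simp only [h0, hx]⟩
  obtain ⟨s, hs, hsI⟩ := (h1.and (Ioo_mem_nhdsGT hpos)).exists
  obtain ⟨z, hz, hd⟩ := (H.descend h0 hγc hγ j (by rw [hpx]; exact ht.2.le)
    (by rwa [hpx]) hs).2
  exact ⟨z, hz, by rw [hd, hpx]⟩

open scoped Topology in
/-- From a vertex other than the base point one can descend along some arc. -/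
theorem exists_descent_of_mem_vertices (H : IsRadialQuotient φ h p G) {x : X} (hx : φ x ∈ G.V)
    (hne : φ x ≠ φ p) : ∃ j, G.arc j (G.hi j) = φ x ∧
      ∃ z, φ z = G.arc j (G.lo j) ∧ dist x z = G.hi j - G.lo j := by
  obtain ⟨γ, h0, hγc, hγ⟩ := H.geodesic.exists_descending p x
  have hpos : 0 < dist p x := dist_pos.2 fun he => hne (by rw [he])
  -- Choose `y` above every vertex height smaller than `dist p x`. Between these two levels the
  -- geodesic meets no vertex, so it lies in an open arc reaching from below `y` up to height at
  -- least `dist p x`.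
  have h1 : ∀ᶠ y in 𝓝[<] (dist p x), ∀ v ∈ G.V, h v < dist p x → h v < y := by
    rw [Filter.eventually_all_finset]
    intro v _
    by_cases hv : h v < dist p x
    · filter_upwards [Ioo_mem_nhdsLT hv] with y hy _ using hy.1
    · exact Filter.Eventually.of_forall fun y h => absurd h hv
  obtain ⟨y, hy, hyI⟩ := (h1.and (Ioo_mem_nhdsLT hpos)).exists
  have hs : (dist p x - y) / 2 ∈ Icc 0 (dist p x) := ⟨by linarith [hyI.2], by linarith [hyI.1]⟩
  have hhs : h (φ (γ ((dist p x - y) / 2))) = (dist p x + y) / 2 := by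
    rw [H.height_apply, (hγ _ hs).1]
    ring
  rcases G.cover (φ (γ ((dist p x - y) / 2))) with hv | ⟨j, t, ht, he⟩
  · have := hy _ hv (by rw [hhs]; linarith [hyI.2])
    rw [hhs] at this
    linarith [hyI.2]
  · have htt : t = (dist p x + y) / 2 := by
      rw [← H.isHeight j t (Ioo_subset_Icc_self ht), he, hhs]
    have hlo : G.lo j < y := by
      have := hy _ (G.arc_lo_mem j) (by rw [H.height_lo]; linarith [ht.1, hyI.2])
      rwa [H.height_lo] at this
    have hhi : dist p x ≤ G.hi j := by
      by_contra hlt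
      have := hy _ (G.arc_hi_mem j) (by rw [H.height_hi]; exact not_le.1 hlt)
      rw [H.height_hi] at this
      linarith [ht.2, hyI.2]
    obtain ⟨⟨t', ht', he'⟩, z, hz, hd⟩ := H.descend h0 hγc hγ j hhi
      (s₀ := (dist p x - y) / 2) ⟨by linarith [hyI.2], by linarith [hyI.2]⟩ ⟨t, ht, he⟩
    have h3 : t' = dist p x := by rw [← H.isHeight j t' ht', he', H.height_apply]
    have h4 : t' = G.hi j := by
      by_contra hne
      exact G.arc_notMem j t' ⟨by linarith [hyI.2], lt_of_le_of_ne ht'.2 hne⟩ (he' ▸ hx)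
    exact ⟨j, h4 ▸ he', z, hz, by rw [hd, ← h3, h4]⟩

/-- Every arc lifts to a geodesic. -/
theorem exists_lift_arc [CompactSpace X] (H : IsRadialQuotient φ h p G) (j : G.J) :
    ∃ y z, φ y = G.arc j (G.hi j) ∧ φ z = G.arc j (G.lo j) ∧ dist y z ≤ G.hi j - G.lo j := by
  -- A given point over the top of `j` may descend along another arc, so a lift is obtained as a
  -- limit of lifts from interior points: the heights realised by the compact set `C` form a closed
  -- set containing the open interval.
  let C : Set (X × X) := {q | φ q.1 ∈ G.arc j '' Icc (G.lo j) (G.hi j) ∧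
    φ q.2 = G.arc j (G.lo j) ∧ dist q.1 q.2 ≤ G.hi j - G.lo j}
  have hφ := H.quotient.continuous
  have hC : IsClosed C :=
    ((G.isClosed_arc j Subset.rfl).preimage (hφ.comp continuous_fst)).inter
      ((isClosed_eq (hφ.comp continuous_snd) continuous_const).inter
        (isClosed_le (continuous_fst.dist continuous_snd) continuous_const))
  have hK : IsClosed ((fun q : X × X => h (φ q.1)) '' C) :=
    (hC.isCompact.image (H.continuous_height.comp (hφ.comp continuous_fst))).isClosed
  have hsub : Ioo (G.lo j) (G.hi j) ⊆ (fun q : X × X => h (φ q.1)) '' C := by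
    intro t ht
    obtain ⟨x, hx⟩ := H.quotient.surjective (G.arc j t)
    obtain ⟨z, hz, hd⟩ := H.exists_descent_of_mem_arc j ht hx
    exact ⟨(x, z), ⟨⟨t, Ioo_subset_Icc_self ht, hx.symm⟩, hz, by simp only [hd]; linarith [ht.2]⟩,
      by simp only [hx, H.isHeight j t (Ioo_subset_Icc_self ht)]⟩
  have hmem : G.hi j ∈ closure (Ioo (G.lo j) (G.hi j)) := by
    rw [closure_Ioo (G.lo_lt_hi j).ne]
    exact right_mem_Icc.2 (G.lo_lt_hi j).le
  obtain ⟨⟨y, z⟩, ⟨⟨t, ht, he⟩, hz, hd⟩, hy⟩ := closure_minimal hsub hK hmem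
  refine ⟨y, z, ?_, hz, hd⟩
  have : t = G.hi j := by rw [← H.isHeight j t ht, he]; exact hy
  rw [← this]
  exact he.symm

/-- One can choose a single descending arc at each vertex other than the base point; `N` consists of
the arcs not chosen. -/
theorem exists_spanning_tree (H : IsRadialQuotient φ h p G) : ∃ N : Finset G.J,
    (∀ v ∈ G.V, v ≠ φ p → ∃ j ∉ N, G.arc j (G.hi j) = v) ∧
      ∀ i ∉ N, ∀ j ∉ N, G.arc i (G.hi i) = G.arc j (G.hi j) → i = j := by
  classical
  have hex : ∀ v : {v // v ∈ G.V ∧ v ≠ φ p}, ∃ j, G.arc j (G.hi j) = v := by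
    rintro ⟨v, hv, hne⟩
    obtain ⟨x, rfl⟩ := H.quotient.surjective v
    obtain ⟨j, hj, -⟩ := H.exists_descent_of_mem_vertices hv hne
    exact ⟨j, hj⟩
  choose par hpar using hex
  let top : G.J → {v // v ∈ G.V ∧ v ≠ φ p} := fun j =>
    ⟨G.arc j (G.hi j), G.arc_hi_mem j, H.arc_hi_ne j⟩
  have hN : ∀ j, j ∉ Finset.univ.filter (fun j => par (top j) ≠ j) ↔ par (top j) = j := by
    simp
  refine ⟨Finset.univ.filter fun j => par (top j) ≠ j, fun v hv hne => ?_, fun i hi j hj hij => ?_⟩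
  · refine ⟨par ⟨v, hv, hne⟩, ?_, hpar _⟩
    rw [hN]
    congr 1
    exact Subtype.ext (hpar _)
  · rw [hN] at hi hj
    rw [← hi, ← hj]
    congr 1
    exact Subtype.ext hij

/-- Cutting arcs off a spanning tree leaves the graph connected, and yields a free image of the
fundamental group. -/
theorem card_le_corank (H : IsRadialQuotient φ h p G) {N : Finset G.J}
    (hN : ∀ v ∈ G.V, v ≠ φ p → ∃ j ∉ N, G.arc j (G.hi j) = v) :
    (N.card : ℕ∞) ≤ corank (FundamentalGroup X p) := by
  classical
  let mid : G.J → ℝ := fun j => (G.lo j + G.hi j) / 2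
  have hmid : ∀ j, mid j ∈ Ioo (G.lo j) (G.hi j) := fun j =>
    ⟨left_lt_add_div_two.2 (G.lo_lt_hi j), add_div_two_lt_right.2 (G.lo_lt_hi j)⟩
  let W : Set R := ((fun j => G.arc j (mid j)) '' (N : Set G.J))ᶜ
  have hWo : IsOpen W := ((N.finite_toSet.image _).isClosed).isOpen_compl
  have hcut : ∀ j, ∀ t ∈ Icc (G.lo j) (G.hi j), G.arc j t ∉ W → j ∈ N ∧ t = mid j := by
    intro j t ht hn
    obtain ⟨i, hi, he⟩ := not_not.1 hn
    have hnot := G.arc_notMem i (mid i) (hmid i)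
    replace he : G.arc i (mid i) = G.arc j t := he
    rw [he] at hnot
    have htI : t ∈ Ioo (G.lo j) (G.hi j) := by
      refine ⟨lt_of_le_of_ne ht.1 fun hlo => hnot ?_, lt_of_le_of_ne ht.2 fun hhi => hnot ?_⟩
      · rw [← hlo]; exact G.arc_lo_mem j
      · rw [hhi]; exact G.arc_hi_mem j
    have hij : i = j := by
      by_contra hne
      exact disjoint_left.1 (G.disjoint_arc hne) ⟨_, hmid i, he⟩ ⟨t, htI, rfl⟩
    subst hij
    exact ⟨hi, G.injOn_arc i ht (Ioo_subset_Icc_self (hmid i)) he.symm⟩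
  have hVW : ∀ v ∈ G.V, v ∈ W := by
    rintro v hv ⟨i, _, rfl⟩
    exact G.arc_notMem i _ (hmid i) hv
  have hseg : ∀ j, ∀ a b, Icc a b ⊆ Icc (G.lo j) (G.hi j) → (j ∈ N → mid j ∉ Icc a b) →
      G.arc j '' Icc a b ⊆ W ∧ IsPreconnected (G.arc j '' Icc a b) := by
    refine fun j a b hsub hj => ⟨?_, isPreconnected_Icc.image _ ((G.continuousOn_arc j).mono hsub)⟩
    rintro _ ⟨t, ht, rfl⟩
    by_contra hn
    obtain ⟨h1, h2⟩ := hcut j t (hsub ht) hn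
    exact hj h1 (h2 ▸ ht)
  -- Tree arcs are uncut, so descending along them joins every vertex to the root within `W`.
  have hvert : ∀ v ∈ G.V, ∃ t ⊆ W, φ p ∈ t ∧ v ∈ t ∧ IsPreconnected t := by
    refine Finset.induction_on_height G.V h fun v hv ih => ?_
    by_cases hvp : v = φ p
    · subst hvp
      exact ⟨{φ p}, singleton_subset_iff.2 (hVW _ hv), rfl, rfl, isPreconnected_singleton⟩
    · obtain ⟨j, hj, rfl⟩ := hN v hv hvp
      obtain ⟨t, htW, hpt, hvt, ht⟩ := ih _ (G.arc_lo_mem j) (by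
        rw [H.height_lo, H.height_hi]; exact G.lo_lt_hi j)
      obtain ⟨h1, h2⟩ := hseg j _ _ Subset.rfl fun hn => absurd hn hj
      exact ⟨t ∪ G.arc j '' Icc (G.lo j) (G.hi j), union_subset htW h1, Or.inl hpt,
        Or.inr ⟨_, right_mem_Icc.2 (G.lo_lt_hi j).le, rfl⟩,
        ht.union _ hvt ⟨_, left_mem_Icc.2 (G.lo_lt_hi j).le, rfl⟩ h2⟩
  have hWc : IsConnected W := by
    refine ⟨⟨φ p, hVW _ H.base_mem⟩, isPreconnected_of_forall (φ p) fun q hq => ?_⟩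
    rcases G.cover q with hv | ⟨j, t, ht, rfl⟩
    · exact hvert q hv
    -- A point above the cut of an arc is joined to its top, any other point to its bottom.
    · by_cases hlt : j ∈ N ∧ mid j ≤ t
      · have hne : mid j ≠ t := fun he => hq ⟨j, hlt.1, by simp only [he]⟩
        obtain ⟨s, hsW, hps, hvs, hs⟩ := hvert _ (G.arc_hi_mem j)
        obtain ⟨h1, h2⟩ := hseg j t (G.hi j) (Icc_subset_Icc_left ht.1.le)
          fun _ hn => hne (le_antisymm hlt.2 hn.1)
        exact ⟨s ∪ G.arc j '' Icc t (G.hi j), union_subset hsW h1, Or.inl hps,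
          Or.inr ⟨t, left_mem_Icc.2 ht.2.le, rfl⟩,
          hs.union _ hvs ⟨_, right_mem_Icc.2 ht.2.le, rfl⟩ h2⟩
      · obtain ⟨s, hsW, hps, hvs, hs⟩ := hvert _ (G.arc_lo_mem j)
        obtain ⟨h1, h2⟩ := hseg j (G.lo j) t (Icc_subset_Icc_right ht.2.le)
          fun hj hn => hlt ⟨hj, hn.2⟩
        exact ⟨s ∪ G.arc j '' Icc (G.lo j) t, union_subset hsW h1, Or.inl hps,
          Or.inr ⟨t, right_mem_Icc.2 ht.1.le, rfl⟩,
          hs.union _ hvs ⟨_, left_mem_Icc.2 ht.1.le, rfl⟩ h2⟩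
  have := H.geodesic.locallyPathConnectedSpace
  have hφ := H.quotient.continuous
  have hpath : ∀ {W : Set R}, IsOpen W → IsConnected W → IsPathConnected (φ ⁻¹' W) :=
    fun {W} hW hWc => (hW.preimage hφ).isConnected_iff_isPathConnected.1
      (isConnected_preimage_of_isOpen H.quotient H.fiber hW hWc)
  have harcc : ∀ j, IsConnected (G.arc j '' Ioo (G.lo j) (G.hi j)) := fun j =>
    (isConnected_Ioo (G.lo_lt_hi j)).image _ ((G.continuousOn_arc j).mono Ioo_subset_Icc_self)
  have hhc : Continuous fun x => h (φ x) := H.continuous_height.comp hφ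
  have hpt : ∀ j, ∀ t ∈ Ioo (G.lo j) (G.hi j), t ≠ mid j →
      ∃ x, x ∈ φ ⁻¹' W ∩ φ ⁻¹' (G.arc j '' Ioo (G.lo j) (G.hi j)) ∧ h (φ x) = t := by
    intro j t ht hne
    obtain ⟨x, hx⟩ := H.quotient.surjective (G.arc j t)
    refine ⟨x, ⟨?_, t, ht, hx.symm⟩, by rw [hx, H.isHeight j t (Ioo_subset_Icc_self ht)]⟩
    rw [mem_preimage, hx]
    by_contra hn
    exact hne (hcut j t (Ioo_subset_Icc_self ht) hn).2
  -- Removing the midpoint splits arc `j` into an upper half, which is the side `A j`, and a lower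
  -- half; both are open because the midpoint height does not occur on the arc within `W`.
  obtain ⟨Φ, hΦ⟩ := exists_surjective_freeGroup (N := N) p (φ ⁻¹' W)
    (fun j => φ ⁻¹' (G.arc j '' Ioo (G.lo j) (G.hi j))) (fun j => {x | mid j < h (φ x)})
    (hWo.preimage hφ) (hpath hWo hWc) (hVW _ H.base_mem)
    (fun j => (G.isOpen_arc j).preimage hφ) (fun j => hpath (G.isOpen_arc j) (harcc j))
    (fun i j hij => (G.disjoint_arc fun he => hij (Subtype.ext he)).preimage φ)
    (fun x => by
      by_cases hx : φ x ∈ W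
      · exact Or.inl hx
      · obtain ⟨i, hi, he⟩ := not_not.1 hx
        exact Or.inr ⟨⟨i, hi⟩, _, hmid i, he⟩)
    (fun j => ((hWo.preimage hφ).inter ((G.isOpen_arc j).preimage hφ)).inter
      (isOpen_lt continuous_const hhc))
    (fun j => by
      convert ((hWo.preimage hφ).inter ((G.isOpen_arc j).preimage hφ)).inter
        (isOpen_lt hhc (continuous_const (y := mid j))) using 1
      ext x
      refine and_congr_right fun hx => ?_
      simp only [mem_ofPred_eq, not_lt]
      refine ⟨fun hle => lt_of_le_of_ne hle fun he => ?_, le_of_lt⟩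
      obtain ⟨hxW, t, ht, hxt⟩ := hx
      rw [← hxt, H.isHeight _ t (Ioo_subset_Icc_self ht)] at he
      refine hxW ⟨j, j.2, ?_⟩
      simp only [← he, hxt])
    (fun j => by
      obtain ⟨x, hx, he⟩ := hpt j ((mid j + G.hi j) / 2)
        ⟨by linarith [(hmid j).1, (hmid j).2], by linarith [(hmid j).2]⟩
        (by linarith [(hmid j).2])
      exact ⟨x, hx, by rw [mem_ofPred_eq, he]; linarith [(hmid j).2]⟩)
    (fun j => by
      obtain ⟨x, hx, he⟩ := hpt j ((G.lo j + mid j) / 2)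
        ⟨by linarith [(hmid j).1, (hmid j).2], by linarith [(hmid j).1, (hmid j).2]⟩
        (by linarith [(hmid j).1])
      exact ⟨x, hx, by rw [mem_ofPred_eq, he]; linarith [(hmid j).1]⟩)
  refine le_iSup₂_of_le N.card ⟨(FreeGroup.freeGroupCongr N.equivFin).toMonoidHom.comp Φ, ?_⟩ le_rfl
  exact (FreeGroup.freeGroupCongr N.equivFin).surjective.comp hΦ

end IsRadialQuotient

/-! ### Distance functions on the weighted graph -/

namespace ArcGraph

variable {R : Type*} [TopologicalSpace R]

theorem exists_interpolation (G : ArcGraph R) (r : R → ℝ)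
    (hr : ∀ j, |r (G.arc j (G.hi j)) - r (G.arc j (G.lo j))| ≤ G.hi j - G.lo j) :
    ∃ ρ : R → ℝ, (∀ v ∈ G.V, ρ v = r v) ∧
      ∀ j, ∀ s ∈ Icc (G.lo j) (G.hi j), ∀ t ∈ Icc (G.lo j) (G.hi j),
        |ρ (G.arc j s) - ρ (G.arc j t)| ≤ |s - t| := by
  classical
  let slope : G.J → ℝ := fun j =>
    (r (G.arc j (G.hi j)) - r (G.arc j (G.lo j))) / (G.hi j - G.lo j)
  have hpos : ∀ j, 0 < G.hi j - G.lo j := fun j => sub_pos.2 (G.lo_lt_hi j)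
  have hslope : ∀ j, |slope j| ≤ 1 := fun j => by
    rw [abs_div, abs_of_pos (hpos j)]
    exact div_le_one_of_le₀ (hr j) (hpos j).le
  choose J T hT hJT using fun q : {q // q ∉ G.V} => (G.cover q.1).resolve_left q.2
  let ρ : R → ℝ := fun q => if hq : q ∈ G.V then r q else
    r (G.arc (J ⟨q, hq⟩) (G.lo (J ⟨q, hq⟩))) + slope (J ⟨q, hq⟩) * (T ⟨q, hq⟩ - G.lo (J ⟨q, hq⟩))
  have hV : ∀ v ∈ G.V, ρ v = r v := fun v hv => by simp only [ρ, hv, dif_pos]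
  have harc : ∀ j, ∀ t ∈ Icc (G.lo j) (G.hi j),
      ρ (G.arc j t) = r (G.arc j (G.lo j)) + slope j * (t - G.lo j) := by
    intro j t ht
    rcases eq_or_lt_of_le ht.1 with h | h
    · rw [← h, hV _ (G.arc_lo_mem j)]
      ring
    rcases eq_or_lt_of_le ht.2 with h' | h'
    · rw [h', hV _ (G.arc_hi_mem j)]
      have := (hpos j).ne'
      simp only [slope]
      field_simp
      ring
    have hn := G.arc_notMem j t ⟨h, h'⟩
    have hj : J ⟨G.arc j t, hn⟩ = j := by
      by_contra hne
      exact disjoint_left.1 (G.disjoint_arc hne) ⟨_, hT _, hJT ⟨G.arc j t, hn⟩⟩ ⟨t, ⟨h, h'⟩, rfl⟩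
    have h1 := hJT ⟨G.arc j t, hn⟩
    have h2 := hT ⟨G.arc j t, hn⟩
    rw [hj] at h1 h2
    have ht' : T ⟨G.arc j t, hn⟩ = t := G.injOn_arc j (Ioo_subset_Icc_self h2) ht h1
    simp only [ρ, hn, dif_neg, not_false_iff, hj, ht']
  refine ⟨ρ, hV, fun j s hs t ht => ?_⟩
  rw [harc j s hs, harc j t ht, show r (G.arc j (G.lo j)) + slope j * (s - G.lo j) -
    (r (G.arc j (G.lo j)) + slope j * (t - G.lo j)) = slope j * (s - t) by ring, abs_mul]
  exact mul_le_of_le_one_left (abs_nonneg _) (hslope j)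

/-- Tightness expresses `ρ v` as the value at a neighbour plus a positive length. A vertex with `ρ v
≤ 0` would thus have a strictly lower neighbour, and descent ends at `a`, where `ρ` vanishes. -/
theorem potential_pos (G : ArcGraph R) {a : R} {ρ : R → ℝ} (h0 : ρ a = 0)
    (htight : ∀ v ∈ G.V, v ≠ a → ∃ j,
      (G.arc j (G.hi j) = v ∧ ρ v = ρ (G.arc j (G.lo j)) + (G.hi j - G.lo j)) ∨
      (G.arc j (G.lo j) = v ∧ ρ v = ρ (G.arc j (G.hi j)) + (G.hi j - G.lo j))) :
    ∀ v ∈ G.V, v = a ∨ 0 < ρ v := by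
  refine Finset.induction_on_height G.V ρ fun v hv ih => ?_
  by_cases hva : v = a
  · exact Or.inl hva
  right
  have key : ∀ u ∈ G.V, ∀ w : ℝ, 0 < w → ρ v = ρ u + w → 0 < ρ v := by
    intro u hu w hw he
    rcases ih u hu (by linarith) with rfl | h <;> linarith
  obtain ⟨j, ⟨-, h1⟩ | ⟨-, h1⟩⟩ := htight v hv hva
  · exact key _ (G.arc_lo_mem j) _ (sub_pos.2 (G.lo_lt_hi j)) h1
  · exact key _ (G.arc_hi_mem j) _ (sub_pos.2 (G.lo_lt_hi j)) h1

open scoped Topology in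
-- A neighbourhood of `y` avoids the finitely many other vertices and the closed arcs not containing
-- `y`. This turns Lipschitz bounds along arcs into local bounds.
theorem eventually_mem_common_arc [T2Space R] (G : ArcGraph R) (y : R) :
    ∀ᶠ z in 𝓝 y, z = y ∨ ∃ j, ∃ s ∈ Icc (G.lo j) (G.hi j), ∃ t ∈ Icc (G.lo j) (G.hi j),
      G.arc j s = y ∧ G.arc j t = z := by
  rcases G.cover y with hy | ⟨j, s, hs, rfl⟩
  · have h1 : ∀ᶠ z in 𝓝 y, ∀ v ∈ G.V, v ≠ y → z ≠ v := by
      rw [Filter.eventually_all_finset]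
      intro v _
      by_cases hv : v = y
      · exact Filter.Eventually.of_forall fun z h => absurd hv h
      · filter_upwards [isOpen_ne.mem_nhds (Ne.symm hv)] with z hz _ using hz
    have h2 : ∀ᶠ z in 𝓝 y, ∀ j, y ∉ G.arc j '' Icc (G.lo j) (G.hi j) →
        z ∉ G.arc j '' Icc (G.lo j) (G.hi j) := by
      rw [Filter.eventually_all]
      intro j
      by_cases hj : y ∈ G.arc j '' Icc (G.lo j) (G.hi j)
      · exact Filter.Eventually.of_forall fun z h => absurd hj h
      · filter_upwards [(G.isClosed_arc j Subset.rfl).isOpen_compl.mem_nhds hj] with z hz _ using hz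
    filter_upwards [h1, h2] with z hz1 hz2
    rcases G.cover z with hz | ⟨j, t, ht, rfl⟩
    · left
      by_contra hne
      exact hz1 z hz hne rfl
    · right
      have ht' := Ioo_subset_Icc_self ht
      by_contra hn
      refine hz2 j ?_ ⟨t, ht', rfl⟩
      rintro ⟨s, hs, hsy⟩
      exact hn ⟨j, s, hs, t, ht', hsy, rfl⟩
  · filter_upwards [(G.isOpen_arc j).mem_nhds ⟨s, hs, rfl⟩] with z hz
    obtain ⟨t, ht, rfl⟩ := hz
    exact Or.inr ⟨j, s, Ioo_subset_Icc_self hs, t, Ioo_subset_Icc_self ht, rfl, rfl⟩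

end ArcGraph

namespace IsRadialQuotient

variable {X R : Type*} [MetricSpace X] [TopologicalSpace R]
  {φ : X → R} {h : R → ℝ} {p : X} {G : ArcGraph R}

theorem arc_lo_ne_arc_hi (H : IsRadialQuotient φ h p G) (j : G.J) :
    G.arc j (G.lo j) ≠ G.arc j (G.hi j) := fun he => by
  have h1 := H.height_lo j
  rw [he, H.height_hi] at h1
  exact (G.lo_lt_hi j).ne' h1

variable [T2Space R]

/-- The distance from the vertex `a` in the weighted graph `G`. -/
theorem exists_potential_vertices (H : IsRadialQuotient φ h p G) {a : R} (ha : a ∈ G.V) :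
    ∃ r : R → ℝ, r a = 0 ∧
      (∀ j, |r (G.arc j (G.hi j)) - r (G.arc j (G.lo j))| ≤ G.hi j - G.lo j) ∧
      ∀ v ∈ G.V, v ≠ a → ∃ j,
        (G.arc j (G.hi j) = v ∧ r v = r (G.arc j (G.lo j)) + (G.hi j - G.lo j)) ∨
        (G.arc j (G.lo j) = v ∧ r v = r (G.arc j (G.hi j)) + (G.hi j - G.lo j)) := by
  classical
  let K : Set (G.V → ℝ) := {r | r ⟨a, ha⟩ = 0 ∧ ∀ j, |r ⟨_, G.arc_hi_mem j⟩ - r ⟨_, G.arc_lo_mem j⟩|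
    ≤ G.hi j - G.lo j}
  have hKc : IsClosed K := by
    refine (isClosed_eq (continuous_apply _) continuous_const).inter ?_
    show IsClosed {r : G.V → ℝ | ∀ j, |r ⟨_, G.arc_hi_mem j⟩ - r ⟨_, G.arc_lo_mem j⟩|
      ≤ G.hi j - G.lo j}
    simp only [ofPred_forall]
    exact isClosed_iInter fun j => isClosed_le (by fun_prop) continuous_const
  -- Descending arc by arc to `φ p` changes `r` by at most the height lost; this bounds `K`.
  have hbase : ∀ r ∈ K, ∀ v (hv : v ∈ G.V), |r ⟨v, hv⟩ - r ⟨φ p, H.base_mem⟩| ≤ h v := by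
    intro r hr
    suffices ∀ v ∈ G.V, ∀ hv : v ∈ G.V, |r ⟨v, hv⟩ - r ⟨φ p, H.base_mem⟩| ≤ h v from
      fun v hv => this v hv hv
    refine Finset.induction_on_height G.V h fun v hv ih _ => ?_
    by_cases hvp : v = φ p
    · subst hvp
      simpa using H.height_nonneg _
    · obtain ⟨x, rfl⟩ := H.quotient.surjective v
      obtain ⟨j, hj, -⟩ := H.exists_descent_of_mem_vertices hv hvp
      have hhj := H.height_hi j
      have h1 := ih _ (G.arc_lo_mem j) (by
        rw [← hj, H.height_lo, H.height_hi]; exact G.lo_lt_hi j) (G.arc_lo_mem j)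
      rw [H.height_lo] at h1
      have h2 := hr.2 j
      simp only [hj] at h2 hhj
      rw [hhj]
      calc _ ≤ _ := abs_sub_le _ (r ⟨_, G.arc_lo_mem j⟩) _
        _ ≤ _ := by linarith
  have hKsub : K ⊆ Set.pi univ fun v : G.V => Icc (-(h v + h a)) (h v + h a) := by
    intro r hr v _
    show r v ∈ Icc (-(h v + h a)) (h v + h a)
    rw [mem_Icc, ← abs_le]
    have h1 := hbase r hr v.1 v.2
    have h2 := hbase r hr a ha
    rw [hr.1, zero_sub, abs_neg] at h2
    calc |r v| = |(r v - r ⟨φ p, H.base_mem⟩) + r ⟨φ p, H.base_mem⟩| := by ring_nf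
      _ ≤ _ := (abs_add_le _ _).trans (add_le_add h1 h2)
  have hK : IsCompact K := (isCompact_univ_pi fun _ => isCompact_Icc).of_isClosed_subset hKc hKsub
  have h0 : (0 : G.V → ℝ) ∈ K := ⟨rfl, fun j => by simpa using (G.lo_lt_hi j).le⟩
  -- The distance from `a` is found as the largest 1-Lipschitz function vanishing at `a`, by
  -- maximising the sum of values: at a vertex with no tight arc the value could be raised by a
  -- small `ε`.
  obtain ⟨r, hrK, hmax⟩ := hK.exists_isMaxOn ⟨0, h0⟩ (f := fun r : G.V → ℝ => ∑ v, r v)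
    (continuous_finsetSum _ fun v _ => continuous_apply v).continuousOn
  let r' : R → ℝ := fun v => if hv : v ∈ G.V then r ⟨v, hv⟩ else 0
  have hr' : ∀ v (hv : v ∈ G.V), r' v = r ⟨v, hv⟩ := fun v hv => by simp only [r', hv, dif_pos]
  refine ⟨r', by rw [hr' a ha, hrK.1], fun j => ?_, fun v hv hva => ?_⟩
  · rw [hr' _ (G.arc_hi_mem j), hr' _ (G.arc_lo_mem j)]
    exact hrK.2 j
  by_contra! hn
  have hev : ∀ᶠ ε in nhdsWithin (0 : ℝ) (Ioi 0), ∀ j,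
      (G.arc j (G.hi j) = v → r ⟨v, hv⟩ + ε ≤ r ⟨_, G.arc_lo_mem j⟩ + (G.hi j - G.lo j)) ∧
      (G.arc j (G.lo j) = v → r ⟨v, hv⟩ + ε ≤ r ⟨_, G.arc_hi_mem j⟩ + (G.hi j - G.lo j)) := by
    rw [Filter.eventually_all]
    intro j
    have small : ∀ c : ℝ, r ⟨v, hv⟩ < c →
        ∀ᶠ ε in nhdsWithin (0 : ℝ) (Ioi 0), r ⟨v, hv⟩ + ε ≤ c := fun c hc => by
      filter_upwards [Ioo_mem_nhdsGT (sub_pos.2 hc)] with ε hε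
      linarith [hε.2]
    have hle := abs_le.1 (hrK.2 j)
    refine Filter.Eventually.and ?_ ?_
    · by_cases hj : G.arc j (G.hi j) = v
      · have h1 := (hn j).1 hj
        rw [hr' v hv, hr' _ (G.arc_lo_mem j)] at h1
        simp only [hj] at hle
        filter_upwards [small _ (lt_of_le_of_ne (by linarith [hle.2]) h1)] with ε hε _ using hε
      · exact Filter.Eventually.of_forall fun _ h => absurd h hj
    · by_cases hj : G.arc j (G.lo j) = v
      · have h1 := (hn j).2 hj
        rw [hr' v hv, hr' _ (G.arc_hi_mem j)] at h1
        simp only [hj] at hle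
        filter_upwards [small _ (lt_of_le_of_ne (by linarith [hle.1]) h1)] with ε hε _ using hε
      · exact Filter.Eventually.of_forall fun _ h => absurd h hj
  obtain ⟨ε, hε, hεpos⟩ := (hev.and self_mem_nhdsWithin).exists
  have hεpos' : (0 : ℝ) < ε := hεpos
  have hmem : Function.update r ⟨v, hv⟩ (r ⟨v, hv⟩ + ε) ∈ K := by
    constructor
    · rw [Function.update_of_ne (fun he => hva (congrArg Subtype.val he).symm), hrK.1]
    · intro j
      have hne := H.arc_lo_ne_arc_hi j
      have hle := abs_le.1 (hrK.2 j)
      by_cases h1 : G.arc j (G.hi j) = v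
      · have h2 : (⟨_, G.arc_hi_mem j⟩ : G.V) = ⟨v, hv⟩ := Subtype.ext h1
        have h3 : (⟨_, G.arc_lo_mem j⟩ : G.V) ≠ ⟨v, hv⟩ := fun he =>
          hne ((congrArg Subtype.val he).trans h1.symm)
        have h4 := (hε j).1 h1
        rw [h2] at hle ⊢
        rw [Function.update_self, Function.update_of_ne h3, abs_le]
        constructor <;> linarith
      · have h2 : (⟨_, G.arc_hi_mem j⟩ : G.V) ≠ ⟨v, hv⟩ := fun he => h1 (congrArg Subtype.val he)
        rw [Function.update_of_ne h2]
        by_cases h3 : G.arc j (G.lo j) = v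
        · have h4 : (⟨_, G.arc_lo_mem j⟩ : G.V) = ⟨v, hv⟩ := Subtype.ext h3
          have h5 := (hε j).2 h3
          rw [h4] at hle ⊢
          rw [Function.update_self, abs_le]
          constructor <;> linarith
        · rw [Function.update_of_ne fun he => h3 (congrArg Subtype.val he)]
          exact hrK.2 j
  have hle : ∑ u, Function.update r ⟨v, hv⟩ (r ⟨v, hv⟩ + ε) u ≤ ∑ u, r u := hmax hmem
  rw [Finset.sum_update_of_mem (Finset.mem_univ _),
    ← Finset.add_sum_erase _ r (Finset.mem_univ (⟨v, hv⟩ : G.V)), Finset.sdiff_singleton_eq_erase]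
    at hle
  linarith

open scoped Topology in
/-- The distance from the vertex `a` in the metric graph `G`. -/
theorem exists_potential (H : IsRadialQuotient φ h p G) {a : R} (ha : a ∈ G.V) :
    ∃ ρ : R → ℝ, ρ a = 0 ∧ (∀ y, ∀ᶠ z in 𝓝 y, |ρ z - ρ y| ≤ |h z - h y|) ∧
      ∀ v ∈ G.V, v ≠ a → ∃ j,
        (G.arc j (G.hi j) = v ∧ ρ v = ρ (G.arc j (G.lo j)) + (G.hi j - G.lo j)) ∨
        (G.arc j (G.lo j) = v ∧ ρ v = ρ (G.arc j (G.hi j)) + (G.hi j - G.lo j)) := by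
  obtain ⟨r, h0, hr, htight⟩ := H.exists_potential_vertices ha
  obtain ⟨ρ, hV, hρ⟩ := G.exists_interpolation r hr
  refine ⟨ρ, by rw [hV a ha, h0], fun y => ?_, fun v hv hva => ?_⟩
  · filter_upwards [G.eventually_mem_common_arc y] with z hz
    rcases hz with rfl | ⟨j, s, hs, t, ht, rfl, rfl⟩
    · simp
    · rw [H.isHeight j s hs, H.isHeight j t ht]
      exact hρ j t ht s hs
  · obtain ⟨j, hj⟩ := htight v hv hva
    refine ⟨j, ?_⟩
    rwa [hV v hv, hV _ (G.arc_lo_mem j), hV _ (G.arc_hi_mem j)]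

/-! ### Lifting shortest paths and counting jumps -/

/-- Lifting a shortest path of the graph, with a jump inside a fibre at each vertex with several
descending arcs and at each local minimum of the path. -/
theorem dist_le_potential [CompactSpace X] (H : IsRadialQuotient φ h p G) {N : Finset G.J}
    (hN : ∀ i ∉ N, ∀ j ∉ N, G.arc i (G.hi i) = G.arc j (G.hi j) → i = j)
    {D : ℝ} (hD : ∀ x y, φ x = φ y → dist x y ≤ D) {x : X} {ρ : R → ℝ} (h0 : ρ (φ x) = 0)
    (htight : ∀ v ∈ G.V, v ≠ φ x → ∃ j,
      (G.arc j (G.hi j) = v ∧ ρ v = ρ (G.arc j (G.lo j)) + (G.hi j - G.lo j)) ∨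
      (G.arc j (G.lo j) = v ∧ ρ v = ρ (G.arc j (G.hi j)) + (G.hi j - G.lo j)))
    {x' : X} (hx' : φ x' ∈ G.V) : dist x x' ≤ ρ (φ x') + (2 * N.card + 1) * D := by
  classical
  have hD0 : 0 ≤ D := dist_nonneg.trans (hD x x rfl)
  let M : Finset R := G.V.filter fun v =>
    ∃ i j, i ≠ j ∧ G.arc i (G.hi i) = v ∧ G.arc j (G.hi j) = v
  have hMmem : ∀ i j, i ≠ j → G.arc i (G.hi i) = G.arc j (G.hi j) → G.arc j (G.hi j) ∈ M :=
    fun i j hij he => Finset.mem_filter.2 ⟨G.arc_hi_mem j, i, j, hij, he, rfl⟩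
  have hM : M.card ≤ N.card := by
    have hsub : M ⊆ N.image fun j => G.arc j (G.hi j) := by
      intro v hv
      obtain ⟨-, i, j, hij, hi, hj⟩ := Finset.mem_filter.1 hv
      rw [Finset.mem_image]
      by_cases hiN : i ∈ N
      · exact ⟨i, hiN, hi⟩
      · by_cases hjN : j ∈ N
        · exact ⟨j, hjN, hj⟩
        · exact absurd (hN i hiN j hjN (hi.trans hj.symm)) hij
    exact (Finset.card_le_card hsub).trans Finset.card_image_le
  -- `M` is the set of tops of several arcs; `C v` counts those strictly closer to `φ x` than `v`,
  -- and `c v` tells whether `v` is one.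
  let C : R → ℕ := fun v => (M.filter fun u => ρ u < ρ v).card
  let c : R → ℕ := fun v => if v ∈ M then 1 else 0
  have hcC : ∀ u v, ρ u < ρ v → (C u : ℝ) + c u ≤ C v := by
    intro u v huv
    have hsub : (M.filter fun w => ρ w < ρ u) ⊆ M.filter fun w => ρ w < ρ v := fun w hw => by
      rw [Finset.mem_filter] at hw ⊢
      exact ⟨hw.1, hw.2.trans huv⟩
    by_cases hu : u ∈ M
    · have h1 : insert u (M.filter fun w => ρ w < ρ u) ⊆ M.filter fun w => ρ w < ρ v :=
        Finset.insert_subset (Finset.mem_filter.2 ⟨hu, huv⟩) hsub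
      have h2 := Finset.card_le_card h1
      rw [Finset.card_insert_of_notMem (by simp)] at h2
      simp only [c, hu, if_true]
      exact_mod_cast h2
    · simp only [c, hu, if_false, Nat.cast_zero, add_zero]
      exact_mod_cast Finset.card_le_card hsub
  have hcN : ∀ v, (C v : ℝ) + c v ≤ N.card := by
    intro v
    refine le_trans ?_ (Nat.cast_le.2 hM)
    by_cases hv : v ∈ M
    · have h1 : insert v (M.filter fun w => ρ w < ρ v) ⊆ M :=
        Finset.insert_subset hv (Finset.filter_subset _ _)
      have h2 := Finset.card_le_card h1
      rw [Finset.card_insert_of_notMem (by simp)] at h2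
      simp only [c, hv, if_true]
      exact_mod_cast h2
    · simp only [c, hv, if_false, Nat.cast_zero, add_zero]
      exact_mod_cast Finset.card_le_card (Finset.filter_subset _ _)
  -- If `j` is the only arc with this top, the geodesic from `z` must follow it; otherwise jump
  -- first to the start of some lift of `j`.
  have hlift : ∀ j z, φ z = G.arc j (G.hi j) → ∃ y, φ y = G.arc j (G.lo j) ∧
      dist z y ≤ (G.hi j - G.lo j) + c (G.arc j (G.hi j)) * D := by
    intro j z hz
    by_cases hv : G.arc j (G.hi j) ∈ M
    · obtain ⟨y, w, hy, hw, hyw⟩ := H.exists_lift_arc j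
      refine ⟨w, hw, (dist_triangle z y w).trans ?_⟩
      have := hD z y (hz.trans hy.symm)
      simp only [c, hv, if_true, Nat.cast_one, one_mul]
      linarith
    · obtain ⟨i, hi, y, hy, hd⟩ := H.exists_descent_of_mem_vertices (x := z)
        (hz ▸ G.arc_hi_mem j) (hz ▸ H.arc_hi_ne j)
      have hij : i = j := by
        by_contra hne
        exact hv (hMmem i j hne (hi.trans hz))
      subst hij
      refine ⟨y, hy, ?_⟩
      simp only [c, hv, if_false, Nat.cast_zero, zero_mul]
      linarith
  -- The first case means that the path has just started or arrives at `v` downwards, with control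
  -- of one point of the fibre. In the second it arrives upwards: lifting the last arc backwards
  -- from any `z` controls the whole fibre, the extra `1` paying for the jump where the ascent
  -- began.
  have main : ∀ v ∈ G.V, (∃ z, φ z = v ∧ dist x z ≤ ρ v + 2 * C v * D) ∨
      ((∃ i, G.arc i (G.hi i) = v ∧ ρ (G.arc i (G.lo i)) < ρ v) ∧
        ∀ z, φ z = v → dist x z ≤ ρ v + (2 * C v + 1 + c v) * D) := by
    refine Finset.induction_on_height G.V ρ fun v hv ih => ?_
    by_cases hvx : v = φ x
    · left
      refine ⟨x, hvx.symm, ?_⟩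
      rw [dist_self, hvx, h0]
      positivity
    obtain ⟨j, ⟨hj, hρ⟩ | ⟨hj, hρ⟩⟩ := htight v hv hvx
    · right
      have hlt : ρ (G.arc j (G.lo j)) < ρ v := by linarith [G.lo_lt_hi j]
      refine ⟨⟨j, hj, hlt⟩, fun z hz => ?_⟩
      obtain ⟨y, hy, hzy⟩ := hlift j z (hz.trans hj.symm)
      rw [hj] at hzy
      have hxy : dist x y ≤ ρ (G.arc j (G.lo j)) +
          (2 * C (G.arc j (G.lo j)) + 1 + c (G.arc j (G.lo j))) * D := by
        rcases ih _ (G.arc_lo_mem j) hlt with ⟨w, hw, hxw⟩ | ⟨-, hu⟩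
        · have h1 := hD w y (hw.trans hy.symm)
          have h2 : 0 ≤ (c (G.arc j (G.lo j)) : ℝ) * D := by positivity
          linarith [dist_triangle x w y]
        · exact hu y hy
      have h1 := mul_le_mul_of_nonneg_right (hcC _ _ hlt) hD0
      have h2 : 0 ≤ (c (G.arc j (G.lo j)) : ℝ) * D := by positivity
      have h3 := dist_triangle x y z
      rw [dist_comm y z] at h3
      linarith
    · left
      have hlt : ρ (G.arc j (G.hi j)) < ρ v := by linarith [G.lo_lt_hi j]
      have h1 := mul_le_mul_of_nonneg_right (hcC _ _ hlt) hD0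
      have h2 : 0 ≤ (c (G.arc j (G.hi j)) : ℝ) * D := by positivity
      rcases ih _ (G.arc_hi_mem j) hlt with ⟨w, hw, hxw⟩ | ⟨⟨i, hi, hilt⟩, hu⟩
      · obtain ⟨y, hy, hwy⟩ := hlift j w hw
        refine ⟨y, hy.trans hj, ?_⟩
        linarith [dist_triangle x w y]
      -- At a local maximum of the path the incoming and outgoing arcs differ, so the vertex is in
      -- `M`. Its two units absorb the pending jump and its own, and since the whole fibre is
      -- controlled, a lift of `j` is reached without a further jump.
      · have hij : i ≠ j := by
          rintro rfl
          rw [hj] at hilt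
          exact hilt.not_gt hlt
        have hM : G.arc j (G.hi j) ∈ M := hMmem i j hij hi
        have hc : (c (G.arc j (G.hi j)) : ℝ) = 1 := by simp only [c, hM, if_true, Nat.cast_one]
        obtain ⟨y, z, hy, hz, hyz⟩ := H.exists_lift_arc j
        refine ⟨z, hz.trans hj, ?_⟩
        have h3 := hu y hy
        rw [hc] at h1 h3
        linarith [dist_triangle x y z]
  have h1 := mul_le_mul_of_nonneg_right (hcN (φ x')) hD0
  have h2 : 0 ≤ (c (φ x') : ℝ) * D := by positivity
  rcases main _ hx' with ⟨z, hz, hxz⟩ | ⟨-, hu⟩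
  · have h3 := hD z x' hz
    linarith [dist_triangle x z x']
  · have h3 := hu x' rfl
    linarith

end IsRadialQuotient

/-! ### The Reeb quotient of a distance function -/

section ReebMap

variable {X : Type*} [TopologicalSpace X] (f : X → ℝ)

theorem isQuotientMap_reebMap : Topology.IsQuotientMap (reebMap f) :=
  isQuotientMap_quot_mk

theorem reebMap_eq_iff {x y : X} : reebMap f x = reebMap f y ↔ contour f x = contour f y :=
  Quotient.eq (r := reebSetoid f)

theorem isPreconnected_fiber_reebMap (a : ReebGraph f) : IsPreconnected (reebMap f ⁻¹' {a}) := by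
  obtain ⟨x, rfl⟩ := (isQuotientMap_reebMap f).surjective a
  have : reebMap f ⁻¹' {reebMap f x} = contour f x := by
    ext y
    rw [mem_preimage, mem_singleton_iff, reebMap_eq_iff]
    constructor
    · intro h
      exact h ▸ mem_contour_self f y
    · intro h
      replace h : y ∈ connectedComponentIn (f ⁻¹' {f x}) x := h
      have hy : f y = f x := (connectedComponentIn_subset _ _ h : y ∈ f ⁻¹' {f x})
      unfold contour
      rw [hy]
      exact (connectedComponentIn_eq h).symm
  rw [this]
  exact isPreconnected_connectedComponentIn

theorem continuous_reebFun {f : X → ℝ} (hf : Continuous f) : Continuous (reebFun f) :=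
  (isQuotientMap_reebMap f).continuous_iff.2 hf

end ReebMap

section Radial

variable {X : Type u} [MetricSpace X]

open scoped Topology in
theorem not_isLocalMin_reebFun (hX : IsGeodesicSpace X) (p : X)
    (q : ReebGraph fun x : X => dist p x) (hq : q ≠ reebMap (fun x : X => dist p x) p) :
    ¬IsLocalMin (reebFun fun x : X => dist p x) q := by
  intro hmin
  obtain ⟨x, rfl⟩ := (isQuotientMap_reebMap fun x : X => dist p x).surjective q
  obtain ⟨γ, h0, hγc, hγ⟩ := hX.exists_descending p x
  have hpos : 0 < dist p x := dist_pos.2 fun he => hq (by rw [he])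
  have h1 : Filter.Tendsto γ (𝓝[>] 0) (𝓝 x) := by
    have := hγc 0 ⟨le_rfl, dist_nonneg⟩
    rw [ContinuousWithinAt, h0] at this
    refine this.mono_left ?_
    rw [← nhdsWithin_Ioc_eq_nhdsGT hpos]
    exact nhdsWithin_mono _ Ioc_subset_Icc_self
  have h2 := ((isQuotientMap_reebMap fun x : X => dist p x).continuous.tendsto x).comp h1
  obtain ⟨s, hs, hsI⟩ := ((h2.eventually hmin).and (Ioo_mem_nhdsGT hpos)).exists
  have h3 : dist p x ≤ dist p (γ s) := hs
  rw [(hγ s (Ioo_subset_Icc_self hsI)).1] at h3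
  linarith [hsI.1]

theorem IsFiniteTopologicalGraph.nonempty_arcGraph {R : Type*} [TopologicalSpace R]
    (hR : IsFiniteTopologicalGraph R) : T2Space R ∧ Nonempty (ArcGraph R) := by
  obtain ⟨n, K, hfin, hdim, ⟨e⟩⟩ := hR
  obtain ⟨G⟩ := K.nonempty_arcGraph hfin hdim
  exact ⟨e.symm.t2Space, ⟨G.map e.symm⟩⟩

theorem exists_isRadialQuotient (hX : IsGeodesicSpace X) (p : X)
    (hR : IsFiniteTopologicalGraph (ReebGraph (fun x : X => dist p x)))
    (F : Finset (ReebGraph (fun x : X => dist p x))) :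
    ∃ G : ArcGraph (ReebGraph (fun x : X => dist p x)), F ⊆ G.V ∧
      IsRadialQuotient (reebMap fun x : X => dist p x) (reebFun fun x : X => dist p x) p G := by
  obtain ⟨hT2, ⟨G⟩⟩ := hR.nonempty_arcGraph
  have hc := continuous_reebFun (f := fun x : X => dist p x) (by fun_prop)
  obtain ⟨G', hG', hp, hF⟩ := G.exists_isHeight hc _ (not_isLocalMin_reebFun hX p) F
  exact ⟨G', hF, hX, isQuotientMap_reebMap _, isPreconnected_fiber_reebMap _, fun _ => rfl, hc,
    hG', hp⟩

/-- Project a geodesic: since `dist p` is 1-Lipschitz, its variation along the geodesic is at most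
the length. -/
theorem reebEDist_reebMap_le (hX : IsGeodesicSpace X) (p x y : X) :
    reebEDist (fun x : X => dist p x) (reebMap _ x) (reebMap _ y) ≤ edist x y := by
  obtain ⟨γ, hγ⟩ := hX.exists_path x y
  refine (iInf_le _ (γ.map (isQuotientMap_reebMap fun x : X => dist p x).continuous)).trans ?_
  have hlip : LipschitzOnWith (nndist x y) (fun s : ℝ => dist p (γ (projIcc 0 1 zero_le_one s)))
      (Icc 0 1) := by
    refine LipschitzOnWith.of_dist_le_mul fun s hs t ht => ?_
    rw [projIcc_of_mem _ hs, projIcc_of_mem _ ht, Real.dist_eq, dist_comm p, dist_comm p]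
    refine (abs_dist_sub_le _ _ p).trans ?_
    rw [hγ, coe_nndist, Real.dist_eq]
  have h1 := hlip.comp_eVariationOn_le (f := fun s : ℝ => dist p (γ (projIcc 0 1 zero_le_one s)))
    (g := fun t : unitInterval => (t : ℝ)) (s := univ) (fun t _ => t.2)
  have h2 : ((fun s : ℝ => dist p (γ (projIcc 0 1 zero_le_one s))) ∘
      fun t : unitInterval => (t : ℝ)) = fun t => dist p (γ t) := by
    funext t
    simp
  rw [h2] at h1
  refine h1.trans ?_
  have h3 : eVariationOn (fun t : unitInterval => (t : ℝ)) univ ≤ 1 := by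
    have h4 := (monotoneOn_id (s := (univ : Set ℝ))).eVariationOn_eq (mem_univ 0) (mem_univ 1)
    have h5 := eVariationOn.comp_le_of_monotoneOn (id : ℝ → ℝ) (s := univ ∩ Icc 0 1)
      (t := (univ : Set unitInterval)) (fun t => (t : ℝ)) (fun _ _ _ _ h => h)
      (fun t _ => ⟨mem_univ _, t.2⟩)
    refine h5.trans (h4.le.trans ?_)
    simp
  calc _ ≤ (nndist x y : ℝ≥0∞) * 1 := by gcongr
    _ = edist x y := by rw [mul_one, edist_nndist]

/-- With `a` and `b` made vertices, the potential from `a` bounds the intrinsic distance below and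
is positive at `b` unless `b = a`. -/
theorem eq_of_reebEDist_eq_zero (hX : IsGeodesicSpace X) (p : X)
    (hR : IsFiniteTopologicalGraph (ReebGraph (fun x : X => dist p x)))
    {a b : ReebGraph (fun x : X => dist p x)} (h : reebEDist _ a b = 0) : a = b := by
  classical
  obtain ⟨hT2, -⟩ := hR.nonempty_arcGraph
  obtain ⟨G, hF, H⟩ := exists_isRadialQuotient hX p hR {a, b}
  obtain ⟨ρ, h0, hloc, htight⟩ := H.exists_potential (hF (by simp : a ∈ _))
  have h2 := ofReal_sub_le_reebEDist _ hloc a b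
  rw [h0, sub_zero, h, nonpos_iff_eq_zero, ENNReal.ofReal_eq_zero] at h2
  rcases G.potential_pos h0 htight b (hF (by simp)) with he | hlt
  · exact he.symm
  · exact absurd h2 hlt.not_ge

variable [CompactSpace X]

theorem contourDiam_ne_top (f : X → ℝ) : contourDiam f ≠ ⊤ := by
  refine ne_top_of_le_ne_top (isCompact_univ (X := X)).isBounded.ediam_ne_top ?_
  exact iSup_le fun x => Metric.ediam_mono (subset_univ _)

theorem dist_le_contourDiam (f : X → ℝ) {x y : X} (h : reebMap f x = reebMap f y) :
    dist x y ≤ (contourDiam f).toReal := by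
  rw [dist_edist]
  refine ENNReal.toReal_mono (contourDiam_ne_top f) ?_
  refine le_iSup_of_le y (Metric.edist_le_ediam_of_mem ?_ (mem_contour_self f y))
  rw [← (reebMap_eq_iff f).1 h]
  exact mem_contour_self f x

theorem edist_le_reebEDist_add (hX : IsGeodesicSpace X) (p : X)
    (hR : IsFiniteTopologicalGraph (ReebGraph (fun x : X => dist p x))) (x y : X) :
    edist x y ≤ reebEDist (fun x : X => dist p x) (reebMap _ x) (reebMap _ y) +
      2 * ((corank (FundamentalGroup X p) : ℝ≥0∞) + 1) * contourDiam (fun x : X => dist p x) := by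
  classical
  obtain ⟨hT2, -⟩ := hR.nonempty_arcGraph
  set f : X → ℝ := fun x => dist p x with hf
  obtain ⟨G, hF, H⟩ := exists_isRadialQuotient hX p hR {reebMap f x, reebMap f y}
  have hx : reebMap f x ∈ G.V := hF (by simp)
  have hy : reebMap f y ∈ G.V := hF (by simp)
  obtain ⟨N, hN, hN'⟩ := H.exists_spanning_tree
  have hcard : (N.card : ℝ≥0∞) ≤ (corank (FundamentalGroup X p) : ℝ≥0∞) := by
    exact_mod_cast ENat.toENNReal_mono (H.card_le_corank hN)
  obtain ⟨ρ, h0, hloc, htight⟩ := H.exists_potential hx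
  have h1 := H.dist_le_potential hN' (fun x y => dist_le_contourDiam f) h0 htight hy
  have h2 := ofReal_sub_le_reebEDist f hloc (reebMap f x) (reebMap f y)
  rw [h0, sub_zero] at h2
  have hD : ENNReal.ofReal (contourDiam f).toReal = contourDiam f :=
    ENNReal.ofReal_toReal (contourDiam_ne_top f)
  calc edist x y = ENNReal.ofReal (dist x y) := edist_dist x y
    _ ≤ ENNReal.ofReal (ρ (reebMap f y) + (2 * N.card + 1) * (contourDiam f).toReal) :=
        ENNReal.ofReal_le_ofReal h1
    _ ≤ ENNReal.ofReal (ρ (reebMap f y)) +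
        ENNReal.ofReal ((2 * N.card + 1) * (contourDiam f).toReal) := ENNReal.ofReal_add_le
    _ ≤ _ := by
        refine add_le_add h2 ?_
        rw [ENNReal.ofReal_mul (by positivity), hD,
          ENNReal.ofReal_add (by positivity) zero_le_one, ENNReal.ofReal_mul zero_le_two,
          ENNReal.ofReal_natCast, ENNReal.ofReal_one, ENNReal.ofReal_ofNat]
        refine mul_le_mul_left ?_ _
        -- The lifting argument gives `2 * N.card + 1`, weakened here to `2 * (N.card + 1)`.
        calc 2 * (N.card : ℝ≥0∞) + 1 ≤ 2 * N.card + 2 := by gcongr; norm_num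
          _ = 2 * (N.card + 1) := by ring
          _ ≤ _ := by gcongr

end Radial

/-! ### Metrisation and the final estimates -/

/-- A copy of a type, to be endowed with a metric. -/
structure MetricCopy (Q : Type u) : Type u where
  val : Q

/-- The bound `hle` makes `d` finite and the identity continuous from the quotient topology to the
metric one; a continuous bijection from a compact space to a Hausdorff one is a homeomorphism. -/
theorem exists_metricSpace_homeomorph {X : Type*} {Q : Type u} [MetricSpace X] [CompactSpace X]
    [TopologicalSpace Q] {φ : X → Q} (hφ : Topology.IsQuotientMap φ) (d : Q → Q → ℝ≥0∞)
    (hself : ∀ a, d a a = 0) (hcomm : ∀ a b, d a b = d b a)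
    (htri : ∀ a b c, d a c ≤ d a b + d b c) (heq : ∀ a b, d a b = 0 → a = b)
    (hle : ∀ x y, d (φ x) (φ y) ≤ edist x y) :
    ∃ (R : Type u) (_ : MetricSpace R) (e : Q ≃ₜ R), ∀ a b, edist (e a) (e b) = d a b := by
  have hfin : ∀ a b, d a b ≠ ⊤ := fun a b => by
    obtain ⟨x, rfl⟩ := hφ.surjective a
    obtain ⟨y, rfl⟩ := hφ.surjective b
    exact ne_top_of_le_ne_top (edist_ne_top x y) (hle x y)
  let m : MetricSpace (MetricCopy Q) :=
    { dist := fun a b => (d a.val b.val).toReal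
      dist_self := fun a => by simp [hself]
      dist_comm := fun a b => by rw [hcomm]
      dist_triangle := fun a b c => by
        rw [← ENNReal.toReal_add (hfin _ _) (hfin _ _)]
        exact ENNReal.toReal_mono (ENNReal.add_ne_top.2 ⟨hfin _ _, hfin _ _⟩) (htri _ _ _)
      eq_of_dist_eq_zero := fun {a b} h => by
        have := heq _ _ (((ENNReal.toReal_eq_zero_iff _).1 h).resolve_right (hfin _ _))
        cases a
        cases b
        simp_all }
  have hd : ∀ a b : MetricCopy Q, edist a b = d a.val b.val := fun a b => by
    rw [edist_dist]
    exact ENNReal.ofReal_toReal (hfin _ _)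
  have hcompact : CompactSpace Q := hφ.surjective.compactSpace hφ.continuous
  let e : Q ≃ MetricCopy Q := ⟨MetricCopy.mk, MetricCopy.val, fun _ => rfl, fun _ => rfl⟩
  have hcont : Continuous e := by
    rw [hφ.continuous_iff]
    refine (LipschitzWith.of_edist_le fun x y => ?_ : LipschitzWith 1 (e ∘ φ)).continuous
    rw [hd]
    exact hle x y
  exact ⟨MetricCopy Q, m, hcont.homeoOfEquivCompactToT2, fun a b => hd _ _⟩
/-- The intrinsic distance of the Reeb graph is a metric inducing the quotient topology; `R` is the
Reeb graph with this metric (unique up to isometry) and `e ∘ reebMap _` is the Reeb quotient map. -/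
theorem theorem5p2 {X : Type u} [MetricSpace X] [CompactSpace X] [Nonempty X]
    (hX : IsGeodesicSpace X) (p : X)
    (hR : IsFiniteTopologicalGraph (ReebGraph (fun x : X => dist p x))) :
    ∃ (R : Type u) (_ : MetricSpace R) (_ : CompactSpace R) (_ : Nonempty R)
      (e : ReebGraph (fun x : X => dist p x) ≃ₜ R),
      (∀ a b, edist (e a) (e b) = reebEDist (fun x : X => dist p x) a b) ∧
      distortion (fun x : X => e (reebMap (fun x : X => dist p x) x)) ≤
        2 * ((corank (FundamentalGroup X p) : ℝ≥0∞) + 1) *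
          contourDiam (fun x : X => dist p x) ∧
      ENNReal.ofReal (GromovHausdorff.ghDist X R) ≤
        ((corank (FundamentalGroup X p) : ℝ≥0∞) + 1) *
          contourDiam (fun x : X => dist p x) := by
  have hq := isQuotientMap_reebMap fun x : X => dist p x
  obtain ⟨R, m, e, he⟩ := exists_metricSpace_homeomorph hq _ (reebEDist_self _) (reebEDist_comm _)
    (reebEDist_triangle _) (fun a b => eq_of_reebEDist_eq_zero hX p hR)
    (reebEDist_reebMap_le hX p)
  have hsurj : Function.Surjective fun x : X => e (reebMap (fun x : X => dist p x) x) :=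
    e.surjective.comp hq.surjective
  have hcompact : CompactSpace R := hsurj.compactSpace (e.continuous.comp hq.continuous)
  have hne : Nonempty R := Nonempty.map e ⟨reebMap _ p⟩
  have hdis : distortion (fun x : X => e (reebMap (fun x : X => dist p x) x)) ≤
      2 * ((corank (FundamentalGroup X p) : ℝ≥0∞) + 1) *
        contourDiam (fun x : X => dist p x) := by
    refine iSup₂_le fun x y => ?_
    have h1 := edist_le_reebEDist_add hX p hR x y
    have h2 := reebEDist_reebMap_le hX p x y
    rw [← he] at h1 h2
    rw [edist_dist, edist_dist, ENNReal.ofReal_le_ofReal_iff dist_nonneg] at h2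
    rw [abs_of_nonneg (sub_nonneg.2 h2), ENNReal.ofReal_sub _ dist_nonneg, tsub_le_iff_left]
    rwa [edist_dist, edist_dist] at h1
  refine ⟨R, m, hcompact, hne, e, he, hdis, ?_⟩
  set B : ℝ≥0∞ := ((corank (FundamentalGroup X p) : ℝ≥0∞) + 1) *
    contourDiam (fun x : X => dist p x) with hB
  rw [mul_assoc, ← hB] at hdis
  by_cases hBtop : B = ⊤
  · rw [hBtop]
    exact le_top
  -- The map is onto with distortion at most `2 * B`, and half the distortion bounds the
  -- Gromov–Hausdorff distance.
  have hgh : GromovHausdorff.ghDist X R ≤ 0 + 2 * B.toReal / 2 + 0 := by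
    refine GromovHausdorff.ghDist_le_of_approx_subsets (s := univ)
      (fun x => e (reebMap (fun x : X => dist p x) x)) (fun x => ⟨x, mem_univ x, by simp⟩)
      (fun y => ?_) fun x y => ?_
    · obtain ⟨x, rfl⟩ := hsurj y
      exact ⟨⟨x, mem_univ x⟩, by simp⟩
    · have h1 := (le_iSup₂ (f := fun x x' : X => ENNReal.ofReal |dist x x' -
        dist (e (reebMap (fun x : X => dist p x) x))
          (e (reebMap (fun x : X => dist p x) x'))|) x.1 y.1).trans hdis
      have h2 := ENNReal.toReal_mono (ENNReal.mul_ne_top ENNReal.ofNat_ne_top hBtop) h1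
      rwa [ENNReal.toReal_ofReal (abs_nonneg _), ENNReal.toReal_mul, ENNReal.toReal_ofNat] at h2
  refine ENNReal.ofReal_le_of_le_toReal (hgh.trans (le_of_eq ?_))
  ring
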